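/- Let $M$ be a smooth $n$-dimensional manifold with a filtration $H_1\subset\cdots\subset H_r=TM$ by smooth subbundles of constant rank such that $[H_w,H_{w'}]\subset H_{w+w'}$ whenever $w+w'\le r$ (a Carnot manifold of step $r\geq 1$). Set $w_j=\min\{w\in\{1,\dots,r\}:\ j\le \operatorname{rk}H_w\}$ for $j=1,\dots,n$. Let $a\in M$ and let $(X_1,\dots,X_n)$ be an $H$-frame near $a$, i.e. a smooth tangent frame over an open neighbourhood of $a$ such that $X_j$ is a section of $H_{w_j}$. *Definitions.* A smooth function $f$ near $a$ has order $N$ at $a$ if $X_{i_1}\cdots X_{i_k}f(a)=0$ whenever $w_{i_1}+\cdots+w_{i_k}<N$, and $X_{i_1}\cdots X_{i_k}f(a)\ne0$ for some $(i_1,\dots,i_k)$ with $w_{i_1}+\cdots+w_{i_k}=N$. Local coordinates $(x_1,\dots,x_n)$ centered at $a$ are linearly adapted if $X_j=\partial_{x_j}$ at $a$ for every $j$; they are privileged at $a$, adapted to $(X_1,\dots,X_n)$, if they are linearly adapted and $x_k$ has order $w_k$ at $a$ for every $k$. For $\alpha\in\mathbb N_0^n$ put $|\alpha|=\sum_i\alpha_i$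 and $\langle\alpha\rangle=\sum_i w_i\alpha_i$; put $t\cdot x=(t^{w_1}x_1,\dots,t^{w_n}x_n)$. A map $f:\mathbb R^n\to\mathbb R^n$ is $w$-homogeneous if $f(t\cdot x)=t\cdot f(x)$ for all $t\in\mathbb R$, $x\in\mathbb R^n$. Let $\|\cdot\|$ be a pseudo-norm, i.e. a continuous function $\mathbb R^n\to[0,\infty)$, positive off $0$, with $\|t\cdot x\|=|t|\,\|x\|$. We write $\Theta=\mathrm O_w(\|x\|^{w+1})$ if $\Theta_k(x)=\mathrm O(\|x\|^{w_k+1})$ near $x=0$ for every $k$. For a local chart $\kappa$ near $a$ with $\kappa(a)=0$, let $\psi_{\kappa(a)}:\mathbb R^n\to\mathbb R^n$ be the map $\hat\psi\circ T$, where $T$ is an affine isomorphism such that $T\circ\kappa$ gives coordinates centered at $a$ and linearly adapted, and $\hat\psi$ is a polynomial map with $\hat\psi_k(x)=x_k+\sum_{\langle\alpha\rangle<w_k,\ |\alpha|\ge2}a_{k\alpha}x^\alpha$ such that $\hat\psi\circ T\circ\kappa$ gives privileged coordinates at $a$ adapted to $(X_1,\dots,X_n)$. Call a diffeomorphism $\phi$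 from an open neighbourhood of $0\in\mathbb R^n$ onto an open subset of $\mathbb R^n$ *admissible* if $\phi'(0)=\mathrm{id}$ and, near $x=0$, $$\phi(x)=\hat\phi(x)+\mathrm O_w(\|x\|^{w+1}),$$ where $\hat\phi:\mathbb R^n\to\mathbb R^n$ is a $w$-homogeneous polynomial diffeomorphism with $\hat\phi'(0)=\mathrm{id}$. **Corollary.** For every chart $\kappa$ near $a$ with $\kappa(a)=0$, the map $\psi_{\kappa(a)}$ exists and is unique. Let $\chi$ be a local chart near $a$. The coordinates given by $\chi$ are privileged at $a$ adapted to $(X_1,\dots,X_n)$ if and only if $\chi$ is of the form $\phi\circ\psi_{\kappa(a)}\circ\kappa$ (on its natural domain), where $\kappa$ is some local chart near $a$ with $\kappa(a)=0$ and $\phi$ is admissible. Moreover, for every chart $\kappa$ near $a$ with $\kappa(a)=0$ given in advance, they are privileged if and only if $\chi=\phi\circ\psi_{\kappa(a)}\circ\kappa$ near $a$ for some admissible $\phi$. -/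

import Mathlib

open scoped Manifold ContDiff Topology

namespace CarnotMfd

noncomputable section

/-- `n`-dimensional Euclidean space, the model of all the manifolds below. -/
abbrev Euc (n : ℕ) : Type := EuclideanSpace ℝ (Fin n)

/-- A (not necessarily continuous) vector field on `M`, given on all of `M`; smoothness is always
required only on an open set. -/
abbrev VField (n : ℕ) (M : Type*) [TopologicalSpace M] [ChartedSpace (Euc n) M] : Type _ :=
  (x : M) → TangentSpace (𝓡 n) x

/-- `X` is a smooth vector field on the set `U`. -/
def SmoothVFieldOn {n : ℕ} {M : Type*} [TopologicalSpace M] [ChartedSpace (Euc n) M]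
    [IsManifold (𝓡 n) ∞ M] (X : VField n M) (U : Set M) : Prop :=
  ContMDiffOn (𝓡 n) (𝓡 n).tangent ∞
    (fun x => (⟨x, X x⟩ : TangentBundle (𝓡 n) M)) U

/-- A step `r` Carnot filtration `H 1 ⊆ ⋯ ⊆ H r = TM` on an `n`-dimensional manifold: the `H w`,
`1 ≤ w ≤ r`, are smooth subbundles of constant rank `rk w` such that `[H w, H w'] ⊆ H (w + w')`
for `w + w' ≤ r`. (Values of `H` and `rk` at other indices are never used.) -/
structure CarnotFiltration (n r : ℕ) (M : Type*) [TopologicalSpace M] [ChartedSpace (Euc n) M]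
    [IsManifold (𝓡 n) ∞ M] where
  /-- The fibers of the subbundles. -/
  H : ℕ → (x : M) → Submodule ℝ (TangentSpace (𝓡 n) x)
  /-- The ranks of the subbundles. -/
  rk : ℕ → ℕ
  one_le_step : 1 ≤ r
  /-- Near every point `H w` is spanned by `rk w` independent smooth vector fields. -/
  subbundle : ∀ w, 1 ≤ w → w ≤ r → ∀ p : M, ∃ U : Set M, IsOpen U ∧ p ∈ U ∧
    ∃ Y : Fin (rk w) → VField n M, (∀ i, SmoothVFieldOn (Y i) U) ∧
      ∀ q ∈ U, LinearIndependent ℝ (fun i => Y i q) ∧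
        Submodule.span ℝ (Set.range fun i => Y i q) = H w q
  mono : ∀ w w', 1 ≤ w → w ≤ w' → w' ≤ r → ∀ x, H w x ≤ H w' x
  top : ∀ x, H r x = ⊤
  bracket : ∀ w w', 1 ≤ w → 1 ≤ w' → w + w' ≤ r →
    ∀ U : Set M, IsOpen U → ∀ Y Z : VField n M, SmoothVFieldOn Y U → SmoothVFieldOn Z U →
      (∀ x ∈ U, Y x ∈ H w x) → (∀ x ∈ U, Z x ∈ H w' x) →
      ∀ x ∈ U, VectorField.mlieBracket (𝓡 n) Y Z x ∈ H (w + w') x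

section Order

variable {n : ℕ} {M : Type*} [TopologicalSpace M] [ChartedSpace (Euc n) M]

/-- The derivative `X f` of the function `f` along the vector field `X`. -/
def lieDeriv (X : VField n M) (f : M → ℝ) : M → ℝ :=
  fun x => mfderiv (𝓡 n) 𝓘(ℝ, ℝ) f x (X x)

/-- `X_I f = X_{i₁} (X_{i₂} (⋯ (X_{iₖ} f)))` for `I = (i₁, …, iₖ)`. -/
def iterDeriv (X : Fin n → VField n M) (I : List (Fin n)) (f : M → ℝ) : M → ℝ :=
  I.foldr (fun i g => lieDeriv (X i) g) f

/-- `⟨I⟩ = w_{i₁} + ⋯ + w_{iₖ}`. -/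
def listWeight (w : Fin n → ℕ) (I : List (Fin n)) : ℕ := (I.map w).sum

/-- `f` has order `N` at `a` with respect to the vector fields `X` of weights `w`. -/
def HasOrder (X : Fin n → VField n M) (w : Fin n → ℕ) (a : M) (f : M → ℝ) (N : ℕ) : Prop :=
  (∀ I : List (Fin n), listWeight w I < N → iterDeriv X I f a = 0) ∧
    ∃ I : List (Fin n), listWeight w I = N ∧ iterDeriv X I f a ≠ 0

/-- The coordinates `θ = (θ₁, …, θₙ)` are centered at `a` and satisfy `X_j(0) = ∂_j`: the
differential of `θ` at `a` maps `X_j(a)` to the `j`-th standard basis vector. -/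
def LinearlyAdapted (X : Fin n → VField n M) (a : M) (θ : M → Euc n) : Prop :=
  θ a = 0 ∧ ∀ j, mfderiv (𝓡 n) 𝓘(ℝ, Euc n) θ a (X j a) = EuclideanSpace.single j (1 : ℝ)

/-- The coordinates `θ` are privileged at `a`, adapted to the frame `X` of weights `w`. -/
def Privileged (X : Fin n → VField n M) (w : Fin n → ℕ) (a : M) (θ : M → Euc n) : Prop :=
  LinearlyAdapted X a θ ∧ ∀ k, HasOrder X w a (fun p => θ p k) (w k)

/-- `κ` is a smooth local chart near `a` such that `κ a = 0`. -/
structure IsCenteredChart (a : M) (κ : OpenPartialHomeomorph M (Euc n)) : Prop where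
  mem_maximalAtlas : κ ∈ IsManifold.maximalAtlas (𝓡 n) ∞ M
  mem_source : a ∈ κ.source
  map_zero : κ a = 0

end Order

section Frames

variable {n r : ℕ} {M : Type*} [TopologicalSpace M] [ChartedSpace (Euc n) M]
  [IsManifold (𝓡 n) ∞ M]

/-- The weight sequence `w_j = min {w ∈ {1, …, r} | j ≤ rk H_w}`, `1 ≤ j ≤ n`; the index `j : Fin n`
stands for `j + 1`. -/
def CarnotFiltration.weight (H : CarnotFiltration n r M) (j : Fin n) : ℕ :=
  sInf {w : ℕ | 1 ≤ w ∧ w ≤ r ∧ (j : ℕ) + 1 ≤ H.rk w}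

/-- `X` is an `H`-frame over `U`: a smooth tangent frame over `U` such that `X_j` is a section of
`H_w` for `w = w_j`. -/
structure IsHFrameOn (H : CarnotFiltration n r M) (X : Fin n → VField n M) (U : Set M) :
    Prop where
  smooth : ∀ j, SmoothVFieldOn (X j) U
  linearIndependent : ∀ x ∈ U, LinearIndependent ℝ (fun j => X j x)
  span_eq_top : ∀ x ∈ U, Submodule.span ℝ (Set.range fun j => X j x) = ⊤
  mem : ∀ j, ∀ x ∈ U, X j x ∈ H.H (H.weight j) x

end Frames

section Anisotropic

variable {n : ℕ}

/-- `⟨α⟩ = w₁ α₁ + ⋯ + wₙ αₙ` for a multi-order `α`. -/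
def multiWeight (w : Fin n → ℕ) (α : Fin n →₀ ℕ) : ℕ := ∑ i, w i * α i

/-- `|α| = α₁ + ⋯ + αₙ` for a multi-order `α`. -/
def multiLength (α : Fin n →₀ ℕ) : ℕ := ∑ i, α i

/-- The anisotropic dilation `t · x = (t^{w₁} x₁, …, t^{wₙ} xₙ)`. -/
def dilation (w : Fin n → ℕ) (t : ℝ) (x : Euc n) : Euc n :=
  WithLp.toLp 2 fun k => t ^ w k * x k

/-- A pseudo-norm for the dilations with weights `w`. -/
structure IsPseudoNorm (w : Fin n → ℕ) (N : Euc n → ℝ) : Prop where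
  continuous : Continuous N
  nonneg : ∀ x, 0 ≤ N x
  pos : ∀ x, x ≠ 0 → 0 < N x
  dilation : ∀ t x, N (dilation w t x) = |t| * N x

/-- `Θ = O_w(‖x‖^{w+1})` near `0`, i.e. `Θ_k(x) = O(‖x‖^{w_k + 1})` for every `k`, where `N` is the
pseudo-norm `‖·‖`. -/
def IsBigOw (w : Fin n → ℕ) (N : Euc n → ℝ) (Θ : Euc n → Euc n) : Prop :=
  ∀ k, (fun x => Θ x k) =O[𝓝 0] fun x => N x ^ (w k + 1)

/-- All the components of the map `f` are polynomials. -/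
def IsPolynomialMap (f : Euc n → Euc n) : Prop :=
  ∃ P : Fin n → MvPolynomial (Fin n) ℝ, ∀ x k, f x k = MvPolynomial.eval (fun i => x i) (P k)

/-- `f (t · x) = t · f x` for all `t` and `x`. -/
def IsWHomogeneous (w : Fin n → ℕ) (f : Euc n → Euc n) : Prop :=
  ∀ t x, f (dilation w t x) = dilation w t (f x)

/-- `f_k(x) = x_k + ∑ a_{kα} x^α` for every `k`, where the (finite) sum is over multi-orders `α`
with `⟨α⟩ < w_k` and `|α| ≥ 2`. -/
def IsTriangularPoly (w : Fin n → ℕ) (f : Euc n → Euc n) : Prop :=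
  ∃ P : Fin n → MvPolynomial (Fin n) ℝ,
    (∀ k, ∀ α ∈ (P k).support, multiWeight w α < w k ∧ 2 ≤ multiLength α) ∧
      ∀ x k, f x k = x k + MvPolynomial.eval (fun i => x i) (P k)

/-- `φ` is a diffeomorphism near the origin such that `φ'(0) = id` and
`φ(x) = φ̂(x) + O_w(‖x‖^{w+1})` near `0`, where `φ̂` is a `w`-homogeneous polynomial diffeomorphism
of `ℝⁿ` such that `φ̂'(0) = id`. -/
structure IsAdmissibleChange (w : Fin n → ℕ) (N : Euc n → ℝ)
    (φ : OpenPartialHomeomorph (Euc n) (Euc n)) : Prop where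
  zero_mem : (0 : Euc n) ∈ φ.source
  contDiffOn : ContDiffOn ℝ ∞ φ φ.source
  contDiffOn_symm : ContDiffOn ℝ ∞ φ.symm φ.target
  hasFDerivAt : HasFDerivAt φ (ContinuousLinearMap.id ℝ (Euc n)) 0
  expansion : ∃ φ' : Diffeomorph 𝓘(ℝ, Euc n) 𝓘(ℝ, Euc n) (Euc n) (Euc n) ∞,
    IsPolynomialMap φ' ∧ IsWHomogeneous w φ' ∧
      HasFDerivAt φ' (ContinuousLinearMap.id ℝ (Euc n)) 0 ∧
      IsBigOw w N fun x => φ x - φ' x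

end Anisotropic

section Psi

variable {n : ℕ} {M : Type*} [TopologicalSpace M] [ChartedSpace (Euc n) M]

/-- `ψ = ψ̂ ∘ T`, where `T` is an affine change of coordinates such that the coordinates `T ∘ κ` are
centered at `a` and linearly adapted, and `ψ̂` is a polynomial map of the above triangular form such
that the coordinates `ψ̂ ∘ T ∘ κ` are privileged at `a`. -/
def IsPsiMap (X : Fin n → VField n M) (w : Fin n → ℕ) (a : M) (κ : M → Euc n)
    (ψ : Euc n → Euc n) : Prop :=
  ∃ (T : Euc n ≃ᵃ[ℝ] Euc n) (ψ' : Euc n → Euc n), LinearlyAdapted X a (fun p => T (κ p)) ∧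
    IsTriangularPoly w ψ' ∧ Privileged X w a (fun p => ψ' (T (κ p))) ∧ ψ = fun x => ψ' (T x)

/-- The map `ψ_{κ(a)}`: the (unique) map `ψ` satisfying `IsPsiMap`. -/
def psiMap (X : Fin n → VField n M) (w : Fin n → ℕ) (a : M) (κ : M → Euc n) : Euc n → Euc n :=
  Classical.epsilon (IsPsiMap X w a κ)

end Psi

end

end CarnotMfd

/-! Read the frame in linearly adapted coordinates at `a`. By the Leibniz rule, orders add up under
products. The algebraic core is that, modulo functions of order at least `N`, every smooth function
equals exactly one polynomial in the coordinates with all weights `< N`. Uniqueness: a word of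
length at most |β|, applied to x^β at `a`, gives a nonzero value only if it is an arrangement of β,
so the shortest monomials are detected (`eq_zero_of_aeval_mem_orderGE`). Existence: since [X_i, X_j]
= ∑ L_k X_k with w_k ≤ w_i + w_j, sorting a word costs only shorter words of no larger weight. It
therefore suffices to test one word per multi-order, and the resulting square linear system is
injective, hence solvable (`exists_sub_aeval_mem_orderGE`). Applied to x_k with `N = w_k`, this
gives the triangular map and its uniqueness (`exists_isPsiMap`).

The second ingredient is analytic: in privileged coordinates, order at least `m` amounts to being
O(‖x‖^m). Both directions compare a function with its isotropic Taylor polynomial, whose monomials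
are then sorted by weight (`IsAdaptedFrame.vanishesToOrder_of_isBigO`,
`IsAdaptedFrame.exists_homogeneous_approx`).

Let θ = ψ ∘ κ be privileged and φ = χ ∘ θ⁻¹ the transition map. Then χ is privileged iff φ(0) = 0,
φ'(0) = id and each φ_k has order at least w_k. In that case the weight-w_k part of φ_k defines φ̂,
a triangular perturbation of the identity and hence a diffeomorphism. Conversely φ̂ + O_w(‖x‖^{w+1})
forces φ_k = O(‖x‖^{w_k}). This is `privileged_iff_exists_admissible`. For the form on the whole
domain, a privileged χ has ψ = id by uniqueness, so κ = χ and φ = id serve. -/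

namespace CarnotMfd

/-! ### Weights of words and of multi-orders. -/

section Weights

variable {n : ℕ}

theorem listWeight_nil (w : Fin n → ℕ) : listWeight w [] = 0 := rfl

theorem listWeight_cons (w : Fin n → ℕ) (i : Fin n) (I : List (Fin n)) :
    listWeight w (i :: I) = w i + listWeight w I := by simp [listWeight]

theorem listWeight_append (w : Fin n → ℕ) (I J : List (Fin n)) :
    listWeight w (I ++ J) = listWeight w I + listWeight w J := by simp [listWeight]

theorem listWeight_one (I : List (Fin n)) : listWeight (fun _ => 1) I = I.length := by
  simp [listWeight]

theorem listWeight_perm (w : Fin n → ℕ) {I J : List (Fin n)} (h : I.Perm J) :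
    listWeight w I = listWeight w J := (h.map w).sum_eq

theorem length_le_listWeight {w : Fin n → ℕ} (hw : ∀ i, 1 ≤ w i) (I : List (Fin n)) :
    I.length ≤ listWeight w I := by
  induction I with
  | nil => simp
  | cons i I ih => rw [listWeight_cons, List.length_cons]; have := hw i; omega

theorem toMultiset_inj {α β : Fin n →₀ ℕ} (h : Finsupp.toMultiset α = Finsupp.toMultiset β) :
    α = β := by
  rw [← Finsupp.toMultiset_toFinsupp α, h, Finsupp.toMultiset_toFinsupp]

/-- The list `(1, …, 1, 2, …, 2, …)` (in some order) in which `i` occurs `α i` times. -/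
noncomputable def multiList (α : Fin n →₀ ℕ) : List (Fin n) := (Finsupp.toMultiset α).toList

theorem coe_multiList (α : Fin n →₀ ℕ) : (multiList α : Multiset (Fin n)) = Finsupp.toMultiset α :=
  Multiset.coe_toList _

theorem listWeight_multiList (w : Fin n → ℕ) (α : Fin n →₀ ℕ) :
    listWeight w (multiList α) = multiWeight w α := by
  have : listWeight w (multiList α) = ((Finsupp.toMultiset α).map w).sum := by
    rw [← coe_multiList, Multiset.map_coe, Multiset.sum_coe, listWeight]
  rw [this, Finsupp.toMultiset_map, Finsupp.sum_toMultiset, Finsupp.sum_mapDomain_index (by simp)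
    (by intros; ring), multiWeight, Finsupp.sum_fintype _ _ (by simp)]
  simp [mul_comm]

theorem exists_perm_multiList (I : List (Fin n)) : ∃ α : Fin n →₀ ℕ, I.Perm (multiList α) := by
  refine ⟨Multiset.toFinsupp (I : Multiset (Fin n)), ?_⟩
  rw [← Multiset.coe_eq_coe, coe_multiList, Multiset.toFinsupp_toMultiset]

theorem multiWeight_add (w : Fin n → ℕ) (α β : Fin n →₀ ℕ) :
    multiWeight w (α + β) = multiWeight w α + multiWeight w β := by
  simp [multiWeight, mul_add, Finset.sum_add_distrib]

theorem multiWeight_single (w : Fin n → ℕ) (i : Fin n) (m : ℕ) :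
    multiWeight w (Finsupp.single i m) = w i * m := by
  simp [multiWeight, Finsupp.single_apply]

theorem multiWeight_one (α : Fin n →₀ ℕ) : multiWeight (fun _ => 1) α = multiLength α := by
  simp [multiWeight, multiLength]

theorem length_multiList (α : Fin n →₀ ℕ) : (multiList α).length = multiLength α := by
  rw [← listWeight_one, listWeight_multiList, multiWeight_one]

theorem mul_le_multiWeight (w : Fin n → ℕ) (α : Fin n →₀ ℕ) (i : Fin n) :
    w i * α i ≤ multiWeight w α :=
  Finset.single_le_sum (f := fun i => w i * α i) (fun _ _ => Nat.zero_le _) (Finset.mem_univ i)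

theorem finite_multiWeight_lt {w : Fin n → ℕ} (hw : ∀ i, 1 ≤ w i) (N : ℕ) :
    {α : Fin n →₀ ℕ | multiWeight w α < N}.Finite := by
  refine (Set.finite_Iic (Finsupp.equivFunOnFinite.symm fun _ : Fin n => N)).subset ?_
  intro α hα i
  have h1 := mul_le_multiWeight w α i
  have h2 : 1 * α i ≤ w i * α i := Nat.mul_le_mul_right _ (hw i)
  have h3 : multiWeight w α < N := hα
  simp only [Finsupp.equivFunOnFinite_symm_apply_apply]
  omega

end Weights

/-! ### Orders of vanishing with respect to derivations of a commutative algebra. -/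

section Derivations

open MvPolynomial

variable {n : ℕ} {A : Type*} [CommRing A] [Algebra ℝ A]

/-- The composition `D_{i₁} ∘ ⋯ ∘ D_{iₖ}`. -/
def iterDer (D : Fin n → Derivation ℝ A A) (I : List (Fin n)) : A →ₗ[ℝ] A :=
  I.foldr (fun i L => (D i : A →ₗ[ℝ] A) ∘ₗ L) LinearMap.id

theorem iterDer_nil (D : Fin n → Derivation ℝ A A) (f : A) : iterDer D [] f = f := rfl

theorem iterDer_cons (D : Fin n → Derivation ℝ A A) (i : Fin n) (I : List (Fin n)) (f : A) :
    iterDer D (i :: I) f = D i (iterDer D I f) := rfl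

theorem iterDer_append_singleton (D : Fin n → Derivation ℝ A A) (i : Fin n) (I : List (Fin n))
    (f : A) : iterDer D (I ++ [i]) f = iterDer D I (D i f) := by
  induction I with
  | nil => rfl
  | cons j I ih => rw [List.cons_append, iterDer_cons, ih, iterDer_cons]

/-- The elements of order at least `N`: all derivatives of weight `< N` vanish at the point `ev`. -/
def orderGE (ev : A →ₐ[ℝ] ℝ) (D : Fin n → Derivation ℝ A A) (w : Fin n → ℕ) (N : ℕ) :
    Submodule ℝ A where
  carrier := {f | ∀ I, listWeight w I < N → ev (iterDer D I f) = 0}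
  zero_mem' I _ := by simp
  add_mem' hf hg I hI := by rw [map_add, map_add, hf I hI, hg I hI, add_zero]
  smul_mem' c f hf I hI := by rw [map_smul, map_smul, hf I hI, smul_zero]

variable {ev : A →ₐ[ℝ] ℝ} {D : Fin n → Derivation ℝ A A} {w : Fin n → ℕ}

theorem mem_orderGE {N : ℕ} {f : A} :
    f ∈ orderGE ev D w N ↔ ∀ I, listWeight w I < N → ev (iterDer D I f) = 0 := Iff.rfl

theorem orderGE_zero (f : A) : f ∈ orderGE ev D w 0 := fun _ hI => absurd hI (Nat.not_lt_zero _)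

theorem orderGE_anti {N N' : ℕ} (h : N ≤ N') : orderGE ev D w N' ≤ orderGE ev D w N :=
  fun _ hf I hI => hf I (hI.trans_le h)

theorem derivation_mem_orderGE {N : ℕ} {f : A} (hf : f ∈ orderGE ev D w N) (i : Fin n) :
    D i f ∈ orderGE ev D w (N - w i) := by
  intro I hI
  rw [← iterDer_append_singleton]
  refine hf _ ?_
  rw [listWeight_append, listWeight_cons, listWeight_nil]
  omega

/-- Leibniz rule, by induction on the word from its right end: the derivation acting first turns `f
* g` into two products of lower total order. The truncated subtraction in `derivation_mem_orderGE`
is harmless, since every element has order at least `0`. -/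
theorem mul_mem_orderGE {N M : ℕ} {f g : A} (hf : f ∈ orderGE ev D w N)
    (hg : g ∈ orderGE ev D w M) : f * g ∈ orderGE ev D w (N + M) := by
  intro I
  induction I using List.reverseRecOn generalizing f g N M with
  | nil =>
    intro h
    rw [listWeight_nil] at h
    rw [iterDer_nil, map_mul]
    rcases Nat.eq_zero_or_pos N with h0 | h0
    · rw [show ev g = 0 from hg [] (by rw [listWeight_nil]; omega), mul_zero]
    · rw [show ev f = 0 from hf [] (by rw [listWeight_nil]; omega), zero_mul]
  | append_singleton I i ih =>
    intro h
    rw [listWeight_append, listWeight_cons, listWeight_nil] at h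
    rw [iterDer_append_singleton, Derivation.leibniz, smul_eq_mul, smul_eq_mul, map_add, map_add,
      ih hf (derivation_mem_orderGE hg i) (by omega),
      ih hg (derivation_mem_orderGE hf i) (by omega), add_zero]

theorem pow_mem_orderGE {N : ℕ} {f : A} (hf : f ∈ orderGE ev D w N) (m : ℕ) :
    f ^ m ∈ orderGE ev D w (N * m) := by
  induction m with
  | zero => exact orderGE_zero _
  | succ m ih => rw [pow_succ, Nat.mul_succ]; exact mul_mem_orderGE ih hf

theorem prod_mem_orderGE {ι : Type*} (s : Finset ι) (f : ι → A) (N : ι → ℕ)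
    (h : ∀ i ∈ s, f i ∈ orderGE ev D w (N i)) :
    ∏ i ∈ s, f i ∈ orderGE ev D w (∑ i ∈ s, N i) := by
  classical
  induction s using Finset.induction_on with
  | empty => exact orderGE_zero _
  | insert a s ha ih =>
    rw [Finset.prod_insert ha, Finset.sum_insert ha]
    exact mul_mem_orderGE (h a (Finset.mem_insert_self a s))
      (ih fun i hi => h i (Finset.mem_insert_of_mem hi))

theorem aeval_monomial_mem_orderGE {x : Fin n → A} {v : Fin n → ℕ}
    (hx : ∀ k, x k ∈ orderGE ev D w (v k)) (α : Fin n →₀ ℕ) (c : ℝ) :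
    aeval x (monomial α c) ∈ orderGE ev D w (multiWeight v α) := by
  rw [aeval_monomial, ← Algebra.smul_def, Finsupp.prod_fintype _ _ (by simp)]
  refine Submodule.smul_mem _ _ (prod_mem_orderGE _ _ _ fun i _ => ?_)
  exact pow_mem_orderGE (hx i) _

theorem aeval_mem_orderGE {x : Fin n → A} {v : Fin n → ℕ}
    (hx : ∀ k, x k ∈ orderGE ev D w (v k)) {p : MvPolynomial (Fin n) ℝ} {N : ℕ}
    (hp : ∀ α ∈ p.support, N ≤ multiWeight v α) : aeval x p ∈ orderGE ev D w N := by
  rw [p.as_sum, map_sum]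
  exact Submodule.sum_mem _ fun α hα =>
    orderGE_anti (hp α hα) (aeval_monomial_mem_orderGE hx α _)

theorem derivation_aeval (d : Derivation ℝ A A) (x : Fin n → A) (p : MvPolynomial (Fin n) ℝ) :
    d (aeval x p) = ∑ k, aeval x (pderiv k p) * d (x k) := by
  induction p using MvPolynomial.induction_on with
  | C a => simp
  | add p q hp hq => simp [hp, hq, add_mul, Finset.sum_add_distrib]
  | mul_X p i hp =>
    simp only [map_mul, aeval_X, Derivation.leibniz, hp, smul_eq_mul, pderiv_X, map_add, add_mul,
      Finset.sum_add_distrib, Finset.mul_sum]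
    congr 1
    · rw [Finset.sum_eq_single i]
      · simp
      · intro b _ hb; simp [hb.symm]
      · simp
    · exact Finset.sum_congr rfl fun k _ => by ring

/-- The elements `x` are linearly adapted coordinates at the point `ev`. -/
structure IsAdaptedCoord (ev : A →ₐ[ℝ] ℝ) (D : Fin n → Derivation ℝ A A) (x : Fin n → A) :
    Prop where
  eval : ∀ k, ev (x k) = 0
  deriv : ∀ j k, ev (D j (x k)) = if j = k then 1 else 0

theorem mem_orderGE_one {v : Fin n → ℕ} (hv : ∀ i, 1 ≤ v i) {f : A} (hf : ev f = 0) :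
    f ∈ orderGE ev D v 1 := by
  intro I hI
  have := length_le_listWeight hv I
  obtain rfl : I = [] := List.length_eq_zero_iff.1 (by omega)
  exact hf

/-- At the point, words no longer than |β| see x^β as if the `D i` were the partial derivatives ∂_i:
the correction terms vanish to too high an isotropic order. This triangularity with respect to
length is what makes polynomials detectable. -/
theorem eval_iterDer_aeval_monomial {x : Fin n → A} (hx : IsAdaptedCoord ev D x)
    (I : List (Fin n)) (β : Fin n →₀ ℕ) (h : I.length ≤ multiLength β) :
    ev (iterDer D I (aeval x (monomial β (1 : ℝ)))) ≠ 0 ↔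
      (I : Multiset (Fin n)) = Finsupp.toMultiset β := by
  have hx1 : ∀ k, x k ∈ orderGE ev D (fun _ => 1) 1 := fun k =>
    mem_orderGE_one (fun _ => le_rfl) (hx.eval k)
  induction I using List.reverseRecOn generalizing β with
  | nil =>
    rw [iterDer_nil]
    by_cases hβ : β = 0
    · subst hβ; simp
    · have h0 : ev (aeval x (monomial β (1 : ℝ))) = 0 := by
        obtain ⟨i, hi⟩ : ∃ i, β i ≠ 0 := by
          by_contra! hc; exact hβ (Finsupp.ext hc)
        rw [aeval_monomial, map_mul, Finsupp.prod_fintype _ _ (by simp), map_prod,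
          Finset.prod_eq_zero (Finset.mem_univ i), mul_zero]
        rw [map_pow, hx.eval, zero_pow hi]
      simp only [h0, ne_eq, not_true_eq_false, false_iff, Multiset.coe_nil]
      intro hc
      exact hβ (toMultiset_inj (by rw [← hc, map_zero]))
  | append_singleton I i ih =>
    rw [List.length_append, List.length_singleton] at h
    have key : ev (iterDer D (I ++ [i]) (aeval x (monomial β (1 : ℝ)))) =
        β i * ev (iterDer D I (aeval x (monomial (β - Finsupp.single i 1) (1 : ℝ)))) := by
      -- The error is ∑ ∂_k(x^β) (D_i x_k - δ_ik): the first factor has isotropic order |β| - 1 ≥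
      -- |I|, and the second vanishes at the point.
      have hd : D i (aeval x (monomial β (1 : ℝ))) -
          aeval x (pderiv i (monomial β (1 : ℝ))) ∈ orderGE ev D (fun _ => 1) (I.length + 1) := by
        have e : D i (aeval x (monomial β (1 : ℝ))) - aeval x (pderiv i (monomial β (1 : ℝ))) =
            ∑ k, aeval x (pderiv k (monomial β (1 : ℝ))) *
              (D i (x k) - if i = k then 1 else 0) := by
          simp [derivation_aeval, mul_sub, Finset.sum_sub_distrib]
        rw [e]
        refine Submodule.sum_mem _ fun k _ => mul_mem_orderGE ?_
          (mem_orderGE_one (fun _ => le_rfl) ?_)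
        · refine aeval_mem_orderGE hx1 fun α hα => ?_
          rw [pderiv_monomial] at hα
          have hα0 := Finset.mem_singleton.1 (support_monomial_subset hα)
          have hk : β k ≠ 0 := by rintro h0; simp [h0] at hα
          have : β = α + Finsupp.single k 1 := by
            rw [hα0, tsub_add_cancel_of_le]
            rwa [Finsupp.single_le_iff, Nat.one_le_iff_ne_zero]
          rw [this, ← multiWeight_one, multiWeight_add, multiWeight_single] at h
          omega
        · rw [map_sub, hx.deriv]; split_ifs <;> simp
      have h2 := hd I (by rw [listWeight_one]; omega)
      rw [map_sub, map_sub, sub_eq_zero] at h2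
      rw [iterDer_append_singleton, h2, pderiv_monomial]
      have e : (monomial (β - Finsupp.single i 1)) ((1 : ℝ) * (β i : ℝ)) =
        (β i : ℝ) • monomial (β - Finsupp.single i 1) (1 : ℝ) := by
          rw [smul_monomial, smul_eq_mul, mul_comm]
      rw [e, map_smul, map_smul, map_smul, smul_eq_mul]
    rw [key]
    by_cases hi : β i = 0
    · simp only [hi, Nat.cast_zero, zero_mul, ne_eq, not_true_eq_false, false_iff]
      intro hc
      have : i ∈ Finsupp.toMultiset β := by rw [← hc]; simp
      rw [Finsupp.mem_toMultiset, Finsupp.mem_support_iff] at this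
      exact this hi
    · have hb : β = (β - Finsupp.single i 1) + Finsupp.single i 1 := by
        rw [tsub_add_cancel_of_le]
        rwa [Finsupp.single_le_iff, Nat.one_le_iff_ne_zero]
      have hl : I.length ≤ multiLength (β - Finsupp.single i 1) := by
        rw [hb, ← multiWeight_one, multiWeight_add, multiWeight_single, multiWeight_one] at h
        omega
      refine mul_ne_zero_iff.trans ((and_congr_right' (ih _ hl)).trans ?_)
      simp only [ne_eq, Nat.cast_eq_zero, hi, not_false_eq_true, true_and]
      conv_rhs => rw [hb, map_add, Finsupp.toMultiset_single, one_smul, ← Multiset.coe_add,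
        Multiset.coe_singleton]
      rw [add_left_inj]

/-- A polynomial with all weights `< N` whose value has order at least `N` vanishes. -/
theorem eq_zero_of_aeval_mem_orderGE {x : Fin n → A} (hx : IsAdaptedCoord ev D x) {N : ℕ}
    {p : MvPolynomial (Fin n) ℝ} (hp : ∀ α ∈ p.support, multiWeight w α < N)
    (h : aeval x p ∈ orderGE ev D w N) : p = 0 := by
  by_contra hp0
  -- For a monomial of minimal length, the word `multiList α` annihilates every other monomial at
  -- the point and so isolates the coefficient of `α`.
  obtain ⟨α, hα, hmin⟩ := p.support.exists_min_image multiLength (support_nonempty.2 hp0)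
  have h0 := h (multiList α) (by rw [listWeight_multiList]; exact hp α hα)
  rw [p.as_sum, map_sum, map_sum, map_sum] at h0
  have e : ∀ β, ev (iterDer D (multiList α) (aeval x (monomial β (p.coeff β)))) =
      p.coeff β * ev (iterDer D (multiList α) (aeval x (monomial β (1 : ℝ)))) := by
    intro β
    have e : monomial β (p.coeff β) = p.coeff β • monomial β (1 : ℝ) := by
      rw [smul_monomial, smul_eq_mul, mul_one]
    rw [e, map_smul, map_smul, map_smul, smul_eq_mul]
  rw [Finset.sum_eq_single α] at h0
  · rw [e] at h0
    refine mul_ne_zero (mem_support_iff.1 hα) ?_ h0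
    exact (eval_iterDer_aeval_monomial hx _ _ (length_multiList α).le).2 (coe_multiList α)
  · intro β hβ hβα
    rw [e, mul_eq_zero]
    right
    by_contra hc
    have := (eval_iterDer_aeval_monomial hx _ β
      ((length_multiList α).le.trans (hmin β hβ))).1 hc
    rw [coe_multiList] at this
    exact hβα (toMultiset_inj this.symm)
  · exact fun h => absurd hα h

/-- The structure equations `[D_i, D_j] = ∑ L_k D_k`, where `w_k ≤ w_i + w_j`. -/
def BracketCompatible (D : Fin n → Derivation ℝ A A) (w : Fin n → ℕ) : Prop :=
  ∀ i j, ∃ L : Fin n → A, (∀ k, w i + w j < w k → L k = 0) ∧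
    ∀ f, D i (D j f) - D j (D i f) = ∑ k, L k * D k f

/-- The ideal generated by all derivatives of `f` of length `< l` and weight `≤ W`. -/
def derivIdeal (D : Fin n → Derivation ℝ A A) (w : Fin n → ℕ) (f : A) (l W : ℕ) : Ideal A :=
  Ideal.span {g | ∃ J, J.length < l ∧ listWeight w J ≤ W ∧ g = iterDer D J f}

theorem derivation_mem_derivIdeal {f g : A} {l W : ℕ} (hg : g ∈ derivIdeal D w f l W)
    (i : Fin n) : D i g ∈ derivIdeal D w f (l + 1) (w i + W) := by
  have hle : derivIdeal D w f l W ≤ derivIdeal D w f (l + 1) (w i + W) := by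
    refine Ideal.span_mono ?_
    rintro _ ⟨J, h1, h2, rfl⟩
    exact ⟨J, by omega, by omega, rfl⟩
  induction hg using Submodule.span_induction with
  | mem g hg =>
    obtain ⟨J, h1, h2, rfl⟩ := hg
    refine Ideal.subset_span ⟨i :: J, ?_, ?_, rfl⟩
    · rw [List.length_cons]; omega
    · rw [listWeight_cons]; omega
  | zero => rw [map_zero]; exact Submodule.zero_mem _
  | add a b _ _ ha hb => rw [map_add]; exact Submodule.add_mem _ ha hb
  | smul c a ha ih =>
    rw [smul_eq_mul, Derivation.leibniz]
    refine Submodule.add_mem _ (Submodule.smul_mem _ _ ih) ?_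
    rw [smul_eq_mul]
    exact Ideal.mul_mem_right _ _ (hle ha)

/-- Swapping two neighbours replaces them by a combination of single `D k` with w_k ≤ w_i + w_j: the
word gets shorter and no heavier. The coefficients are elements of `A`, and derivations acting from
the left differentiate them, which is why the error is tracked in an ideal. -/
theorem iterDer_sub_mem_derivIdeal (hD : BracketCompatible D w) (f : A) {I J : List (Fin n)}
    (h : I.Perm J) :
    iterDer D I f - iterDer D J f ∈ derivIdeal D w f I.length (listWeight w I) := by
  induction h with
  | nil => rw [sub_self]; exact Submodule.zero_mem _
  | cons i h ih =>
    rw [iterDer_cons, iterDer_cons, ← map_sub, List.length_cons, listWeight_cons]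
    exact derivation_mem_derivIdeal ih i
  | swap i j I =>
    obtain ⟨L, hL0, hL⟩ := hD j i
    rw [iterDer_cons, iterDer_cons, iterDer_cons, iterDer_cons, hL]
    refine Submodule.sum_mem _ fun k _ => ?_
    by_cases hk : w j + w i < w k
    · rw [hL0 k hk, zero_mul]; exact Submodule.zero_mem _
    · refine Ideal.mul_mem_left _ _ (Ideal.subset_span ⟨k :: I, ?_, ?_, rfl⟩)
      · simp
      · simp only [listWeight_cons]; omega
  | trans h1 _ ih1 ih2 =>
    rw [← h1.length_eq, ← listWeight_perm w h1] at ih2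
    rw [← sub_add_sub_cancel]
    exact Submodule.add_mem _ ih1 ih2

/-- It suffices to test the order of vanishing on one arrangement of every multi-order. -/
theorem mem_orderGE_of_multiList (hD : BracketCompatible D w) {f : A} {N : ℕ}
    (h : ∀ α, multiWeight w α < N → ev (iterDer D (multiList α) f) = 0) :
    f ∈ orderGE ev D w N := by
  intro I
  induction hl : I.length using Nat.strong_induction_on generalizing I with
  | _ l ih =>
    intro hI
    obtain ⟨α, hα⟩ := exists_perm_multiList I
    have h1 := iterDer_sub_mem_derivIdeal hD f hα
    -- The generators are derivatives along shorter words of weight still `< N`, so they vanish at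
    -- the point by induction on length.
    have h2 : derivIdeal D w f I.length (listWeight w I) ≤ RingHom.ker ev := by
      refine Ideal.span_le.2 ?_
      rintro _ ⟨J, hJl, hJw, rfl⟩
      exact ih _ (hl ▸ hJl) J rfl (hJw.trans_lt hI)
    have h3 : ev (iterDer D I f - iterDer D (multiList α) f) = 0 := h2 h1
    rw [map_sub, sub_eq_zero] at h3
    rw [h3]
    exact h α (by rwa [← listWeight_multiList, ← listWeight_perm w hα])

/-- Modulo elements of order at least `N`, every element is a unique polynomial with weights
`< N` in the linearly adapted coordinates. -/
theorem exists_sub_aeval_mem_orderGE (hw : ∀ i, 1 ≤ w i) (hD : BracketCompatible D w)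
    {x : Fin n → A} (hx : IsAdaptedCoord ev D x) (f : A) (N : ℕ) :
    ∃ p : MvPolynomial (Fin n) ℝ, (∀ α ∈ p.support, multiWeight w α < N) ∧
      f - aeval x p ∈ orderGE ev D w N := by
  classical
  set S : Finset (Fin n →₀ ℕ) := (finite_multiWeight_lt hw N).toFinset with hS
  have hmem : ∀ α, α ∈ S ↔ multiWeight w α < N := fun α => by simp [hS]
  let P : (S → ℝ) →ₗ[ℝ] MvPolynomial (Fin n) ℝ := ∑ α : S, (monomial α.1) ∘ₗ LinearMap.proj α
  have hP : ∀ c, P c = ∑ α : S, monomial α.1 (c α) := fun c => by simp [P]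
  have hsupp : ∀ c, ∀ α ∈ (P c).support, multiWeight w α < N := by
    intro c α hα
    rw [hP] at hα
    obtain ⟨β, -, hβ⟩ := Finset.mem_biUnion.1 (support_sum hα)
    rw [Finset.mem_singleton.1 (support_monomial_subset hβ)]
    exact (hmem _).1 β.2
  -- Coefficients of a polynomial go to its sorted derivatives at the point. Both sides are indexed
  -- by the multi-orders of weight `< N`, so injectivity gives surjectivity.
  let Φ : (S → ℝ) →ₗ[ℝ] (S → ℝ) := LinearMap.pi fun α =>
    ev.toLinearMap ∘ₗ iterDer D (multiList α.1) ∘ₗ (aeval x).toLinearMap ∘ₗ P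
  have hinj : Function.Injective Φ := by
    rw [injective_iff_map_eq_zero]
    intro c hc
    have h1 : P c = 0 := by
      refine eq_zero_of_aeval_mem_orderGE hx (hsupp c) (mem_orderGE_of_multiList hD ?_)
      intro α hα
      exact congrFun hc ⟨α, (hmem α).2 hα⟩
    ext β
    have h2 := congrArg (coeff β.1) h1
    rw [hP, coeff_sum, Finset.sum_eq_single β] at h2
    · simpa using h2
    · intro γ _ hγ
      rw [coeff_monomial, if_neg fun h => hγ (Subtype.ext h)]
    · simp
  obtain ⟨c, hc⟩ := (LinearMap.injective_iff_surjective.1 hinj)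
    fun α => ev (iterDer D (multiList α.1) f)
  refine ⟨P c, hsupp c, mem_orderGE_of_multiList hD fun α hα => ?_⟩
  have := congrFun hc ⟨α, (hmem α).2 hα⟩
  rw [map_sub, map_sub, sub_eq_zero]
  exact this.symm

theorem coeff_single_eq_eval_derivation {x : Fin n → A} (hx : IsAdaptedCoord ev D x)
    (p : MvPolynomial (Fin n) ℝ) (j : Fin n) :
    p.coeff (Finsupp.single j 1) = ev (D j (aeval x p)) := by
  have h0 : ∀ q : MvPolynomial (Fin n) ℝ, ev (aeval x q) = coeff 0 q := by
    intro q
    rw [← AlgHom.comp_apply, ← constantCoeff_eq]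
    have : (ev.comp (aeval x) : MvPolynomial (Fin n) ℝ →ₐ[ℝ] ℝ) = aeval (fun _ => (0 : ℝ)) := by
      ext k; simp [hx.eval]
    rw [this]
    simp
  rw [derivation_aeval, map_sum, Finset.sum_eq_single j]
  · rw [map_mul, hx.deriv, if_pos rfl, mul_one, h0, coeff_pderiv]
    simp
  · intro k _ hk
    rw [map_mul, hx.deriv, if_neg hk.symm, mul_zero]
  · simp

end Derivations

end CarnotMfd

namespace CarnotMfd

/-! ### Germs of smooth functions and adapted frames at the origin of ℝⁿ. -/

section Germs

variable {n : ℕ}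

/-- The functions on `ℝⁿ` that are smooth at the origin. -/
def smoothAtZero (n : ℕ) : Subalgebra ℝ (Euc n → ℝ) where
  carrier := {f | ContDiffAt ℝ ∞ f 0}
  mul_mem' {f g} (hf : ContDiffAt ℝ ∞ f 0) (hg : ContDiffAt ℝ ∞ g 0) := hf.mul hg
  add_mem' {f g} (hf : ContDiffAt ℝ ∞ f 0) (hg : ContDiffAt ℝ ∞ g 0) := hf.add hg
  algebraMap_mem' c := (contDiffAt_const : ContDiffAt ℝ ∞ (fun _ : Euc n => c) 0)

/-- The ideal of functions that vanish near the origin. -/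
def nullIdeal (n : ℕ) : Ideal (smoothAtZero n) where
  carrier := {f | f.1 =ᶠ[𝓝 0] 0}
  zero_mem' := Filter.EventuallyEq.rfl
  add_mem' hf hg := by simpa using Filter.EventuallyEq.add hf hg
  smul_mem' c f hf := by
    have hf' : f.1 =ᶠ[𝓝 0] 0 := hf
    filter_upwards [hf'] with y hy
    simp [hy]

/-- Germs at the origin of smooth functions. -/
def SmoothGerm (n : ℕ) : Type := smoothAtZero n ⧸ nullIdeal n

instance : CommRing (SmoothGerm n) := inferInstanceAs (CommRing (smoothAtZero n ⧸ nullIdeal n))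

instance : Algebra ℝ (SmoothGerm n) := inferInstanceAs (Algebra ℝ (smoothAtZero n ⧸ nullIdeal n))

/-- The germ of a smooth function. -/
def toGerm (f : Euc n → ℝ) (hf : ContDiffAt ℝ ∞ f 0) : SmoothGerm n :=
  Ideal.Quotient.mk _ ⟨f, hf⟩

theorem exists_toGerm (g : SmoothGerm n) : ∃ f hf, toGerm f hf = g := by
  obtain ⟨f, rfl⟩ := Ideal.Quotient.mk_surjective g
  exact ⟨f.1, f.2, rfl⟩

theorem toGerm_eq_iff {f g : Euc n → ℝ} {hf : ContDiffAt ℝ ∞ f 0} {hg : ContDiffAt ℝ ∞ g 0} :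
    toGerm f hf = toGerm g hg ↔ f =ᶠ[𝓝 0] g := by
  refine (Ideal.Quotient.eq (I := nullIdeal n)).trans ?_
  exact Filter.eventuallyEq_iff_sub.symm

theorem toGerm_add {f g : Euc n → ℝ} (hf : ContDiffAt ℝ ∞ f 0) (hg : ContDiffAt ℝ ∞ g 0) :
    toGerm f hf + toGerm g hg = toGerm (fun y => f y + g y) (hf.add hg) := rfl

theorem toGerm_sub {f g : Euc n → ℝ} (hf : ContDiffAt ℝ ∞ f 0) (hg : ContDiffAt ℝ ∞ g 0) :
    toGerm f hf - toGerm g hg = toGerm (fun y => f y - g y) (hf.sub hg) := rfl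

theorem toGerm_mul {f g : Euc n → ℝ} (hf : ContDiffAt ℝ ∞ f 0) (hg : ContDiffAt ℝ ∞ g 0) :
    toGerm f hf * toGerm g hg = toGerm (fun y => f y * g y) (hf.mul hg) := rfl

theorem smul_toGerm (c : ℝ) {f : Euc n → ℝ} (hf : ContDiffAt ℝ ∞ f 0) :
    c • toGerm f hf = toGerm (fun y => c * f y) (contDiffAt_const.mul hf) := rfl

theorem sum_toGerm {ι : Type*} (s : Finset ι) (F : ι → Euc n → ℝ)
    (hF : ∀ i, ContDiffAt ℝ ∞ (F i) 0) :
    ∑ i ∈ s, toGerm (F i) (hF i) =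
      toGerm (fun y => ∑ i ∈ s, F i y) (ContDiffAt.sum fun i _ => hF i) := by
  classical
  induction s using Finset.induction_on with
  | empty => rfl
  | insert a s ha ih =>
    rw [Finset.sum_insert ha, ih, toGerm_add, toGerm_eq_iff]
    exact Filter.Eventually.of_forall fun y => by simp [Finset.sum_insert ha]

theorem two_le_infty : (2 : WithTop ℕ∞) ≤ ∞ := 
  WithTop.coe_le_coe.2 (le_top : (2 : ℕ∞) ≤ ⊤)

/-- The value of a germ at the origin. -/
def evalGerm (n : ℕ) : SmoothGerm n →ₐ[ℝ] ℝ :=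
  Ideal.Quotient.liftₐ _ ((Pi.evalAlgHom ℝ (fun _ : Euc n => ℝ) 0).comp (smoothAtZero n).val)
    fun f (hf : f.1 =ᶠ[𝓝 0] 0) => hf.eq_of_nhds

theorem evalGerm_toGerm {f : Euc n → ℝ} (hf : ContDiffAt ℝ ∞ f 0) :
    evalGerm n (toGerm f hf) = f 0 := rfl

/-- The derivative of `f` along the vector field `Y` of `ℝⁿ`. -/
noncomputable def vDeriv (Y : Euc n → Euc n) (f : Euc n → ℝ) : Euc n → ℝ :=
  fun y => fderiv ℝ f y (Y y)

theorem contDiffAt_vDeriv {Y : Euc n → Euc n} {f : Euc n → ℝ} {x : Euc n}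
    (hY : ContDiffAt ℝ ∞ Y x) (hf : ContDiffAt ℝ ∞ f x) : ContDiffAt ℝ ∞ (vDeriv Y f) x :=
  (hf.fderiv_right (m := ∞) (by simp)).clm_apply hY

theorem vDeriv_congr (Y : Euc n → Euc n) {f g : Euc n → ℝ} {x : Euc n} (h : f =ᶠ[𝓝 x] g) :
    vDeriv Y f =ᶠ[𝓝 x] vDeriv Y g := by
  filter_upwards [h.fderiv (𝕜 := ℝ)] with y hy
  rw [vDeriv, hy, vDeriv]

theorem eventually_differentiableAt {f : Euc n → ℝ} {x : Euc n} (hf : ContDiffAt ℝ ∞ f x) :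
    ∀ᶠ y in 𝓝 x, DifferentiableAt ℝ f y := by
  have h1 : ContDiffAt ℝ 1 f x := hf.of_le (by exact_mod_cast le_top)
  filter_upwards [h1.eventually (by simp)] with y hy
  exact hy.differentiableAt one_ne_zero

/-- The derivation of germs defined by a smooth vector field. -/
noncomputable def germDerivation (Y : Euc n → Euc n) (hY : ContDiffAt ℝ ∞ Y 0) :
    Derivation ℝ (SmoothGerm n) (SmoothGerm n) :=
  -- `d` differentiates a chosen representative; `hd` shows that the choice is immaterial.
  let d : SmoothGerm n → SmoothGerm n := fun g =>
    toGerm (vDeriv Y (exists_toGerm g).choose)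
      (contDiffAt_vDeriv hY (exists_toGerm g).choose_spec.choose)
  have hd : ∀ f hf, d (toGerm f hf) = toGerm (vDeriv Y f) (contDiffAt_vDeriv hY hf) := fun f hf =>
    toGerm_eq_iff.2 (vDeriv_congr Y
      (toGerm_eq_iff.1 (exists_toGerm (toGerm f hf)).choose_spec.choose_spec))
  Derivation.mk'
    { toFun := d
      map_add' := by
        intro g₁ g₂
        obtain ⟨f₁, hf₁, rfl⟩ := exists_toGerm g₁
        obtain ⟨f₂, hf₂, rfl⟩ := exists_toGerm g₂
        rw [toGerm_add, hd, hd, hd, toGerm_add, toGerm_eq_iff]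
        filter_upwards [eventually_differentiableAt hf₁, eventually_differentiableAt hf₂]
          with y h1 h2
        simp [vDeriv, fderiv_fun_add h1 h2]
      map_smul' := by
        intro c g
        obtain ⟨f, hf, rfl⟩ := exists_toGerm g
        rw [smul_toGerm, hd, hd, RingHom.id_apply, smul_toGerm, toGerm_eq_iff]
        filter_upwards [eventually_differentiableAt hf] with y h
        simp [vDeriv, fderiv_const_mul h] }
    (by
      intro g₁ g₂
      obtain ⟨f₁, hf₁, rfl⟩ := exists_toGerm g₁
      obtain ⟨f₂, hf₂, rfl⟩ := exists_toGerm g₂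
      simp only [LinearMap.coe_mk, AddHom.coe_mk, smul_eq_mul]
      rw [toGerm_mul, hd, hd, hd, toGerm_mul, toGerm_mul, toGerm_add, toGerm_eq_iff]
      filter_upwards [eventually_differentiableAt hf₁, eventually_differentiableAt hf₂]
        with y h1 h2
      simp [vDeriv, fderiv_fun_mul h1 h2])

theorem germDerivation_toGerm {Y : Euc n → Euc n} (hY : ContDiffAt ℝ ∞ Y 0) {f : Euc n → ℝ}
    (hf : ContDiffAt ℝ ∞ f 0) :
    germDerivation Y hY (toGerm f hf) = toGerm (vDeriv Y f) (contDiffAt_vDeriv hY hf) :=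
  toGerm_eq_iff.2 (vDeriv_congr Y
    (toGerm_eq_iff.1 (exists_toGerm (toGerm f hf)).choose_spec.choose_spec))

theorem vDeriv_commutator {Y Z : Euc n → Euc n} {f : Euc n → ℝ} {x : Euc n}
    (hY : ContDiffAt ℝ 2 Y x) (hZ : ContDiffAt ℝ 2 Z x) (hf : ContDiffAt ℝ 2 f x) :
    vDeriv Y (vDeriv Z f) x - vDeriv Z (vDeriv Y f) x =
      fderiv ℝ f x (VectorField.lieBracket ℝ Y Z x) := by
  have h0 : (2 : WithTop ℕ∞) ≠ 0 := by simp
  have hdf : DifferentiableAt ℝ (fderiv ℝ f) x :=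
    (hf.fderiv_right (m := 1) (by norm_num)).differentiableAt one_ne_zero
  have hsymm := (hf.isSymmSndFDerivAt (by simp)).eq (Y x) (Z x)
  have e : ∀ {V W : Euc n → Euc n}, ContDiffAt ℝ 2 V x → ContDiffAt ℝ 2 W x →
      vDeriv V (vDeriv W f) x =
        fderiv ℝ (fderiv ℝ f) x (V x) (W x) + fderiv ℝ f x (fderiv ℝ W x (V x)) := by
    intro V W _ hW
    have := fderiv_clm_apply hdf (hW.differentiableAt h0)
    unfold vDeriv
    rw [this]
    simp [add_comm]
  rw [e hY hZ, e hZ hY, hsymm, VectorField.lieBracket, map_sub]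
  ring

/-- Smooth vector fields near the origin of `ℝⁿ` that equal the standard basis at the origin and
whose brackets satisfy `[Y_i, Y_j] = ∑ L_k Y_k` with `w_k ≤ w_i + w_j`. -/
structure IsAdaptedFrame (w : Fin n → ℕ) (Y : Fin n → Euc n → Euc n) : Prop where
  smooth : ∀ i, ContDiffAt ℝ ∞ (Y i) 0
  eq_single : ∀ j, Y j 0 = EuclideanSpace.single j (1 : ℝ)
  bracket : ∀ i j, ∃ L : Fin n → Euc n → ℝ, (∀ k, ContDiffAt ℝ ∞ (L k) 0) ∧
    (∀ k, w i + w j < w k → L k =ᶠ[𝓝 0] 0) ∧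
    ∀ᶠ y in 𝓝 0, VectorField.lieBracket ℝ (Y i) (Y j) y = ∑ k, L k y • Y k y

/-- Iterated derivatives along vector fields of `ℝⁿ`. -/
noncomputable def iterVDeriv (Y : Fin n → Euc n → Euc n) (I : List (Fin n)) (f : Euc n → ℝ) :
    Euc n → ℝ := I.foldr (fun i g => vDeriv (Y i) g) f

/-- The smooth function `f` on `ℝⁿ` has order at least `N` at the origin. -/
def VanishesToOrder (Y : Fin n → Euc n → Euc n) (w : Fin n → ℕ) (N : ℕ) (f : Euc n → ℝ) : Prop :=
  ∀ I, listWeight w I < N → iterVDeriv Y I f 0 = 0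

theorem contDiffAt_iterVDeriv {Y : Fin n → Euc n → Euc n} {x : Euc n}
    (hY : ∀ i, ContDiffAt ℝ ∞ (Y i) x) {f : Euc n → ℝ} (hf : ContDiffAt ℝ ∞ f x)
    (I : List (Fin n)) : ContDiffAt ℝ ∞ (iterVDeriv Y I f) x := by
  induction I with
  | nil => exact hf
  | cons i I ih => exact contDiffAt_vDeriv (hY i) ih

theorem iterVDeriv_append_singleton (Y : Fin n → Euc n → Euc n) (I : List (Fin n)) (i : Fin n)
    (f : Euc n → ℝ) : iterVDeriv Y (I ++ [i]) f = iterVDeriv Y I (vDeriv (Y i) f) := by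
  simp [iterVDeriv]

variable {w : Fin n → ℕ} {Y : Fin n → Euc n → Euc n}

theorem vanishesToOrder_iff (hY : ∀ i, ContDiffAt ℝ ∞ (Y i) 0) {f : Euc n → ℝ}
    (hf : ContDiffAt ℝ ∞ f 0) {N : ℕ} : VanishesToOrder Y w N f ↔
      toGerm f hf ∈ orderGE (evalGerm n) (fun i => germDerivation (Y i) (hY i)) w N := by
  have h : ∀ I, iterDer (fun i => germDerivation (Y i) (hY i)) I (toGerm f hf) =
      toGerm (iterVDeriv Y I f) (contDiffAt_iterVDeriv hY hf I) := by
    intro I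
    induction I with
    | nil => rfl
    | cons i I ih => rw [iterDer_cons, ih, germDerivation_toGerm]; rfl
  simp only [mem_orderGE, h, evalGerm_toGerm]
  rfl

theorem contDiffAt_coord (k : Fin n) (x : Euc n) : ContDiffAt ℝ ∞ (fun y : Euc n => y k) x :=
  (EuclideanSpace.proj (𝕜 := ℝ) k).contDiff.contDiffAt

theorem fderiv_coord (k : Fin n) (x v : Euc n) : fderiv ℝ (fun y : Euc n => y k) x v = v k := by
  have := (EuclideanSpace.proj (𝕜 := ℝ) k : Euc n →L[ℝ] ℝ).fderiv (x := x)
  exact congrArg (fun L => L v) this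

/-- The polynomial function on `ℝⁿ` defined by `p`. -/
noncomputable def polyFun (p : MvPolynomial (Fin n) ℝ) (y : Euc n) : ℝ :=
  MvPolynomial.eval (fun i => y i) p

theorem contDiff_polyFun (p : MvPolynomial (Fin n) ℝ) : ContDiff ℝ ∞ (polyFun p) := by
  induction p using MvPolynomial.induction_on with
  | C a =>
    rw [show polyFun (MvPolynomial.C a) = fun _ : Euc n => a by ext y; simp [polyFun]]
    exact contDiff_const
  | add p q hp hq =>
    rw [show polyFun (p + q) = fun y => polyFun p y + polyFun q y by ext y; simp [polyFun]]
    exact hp.add hq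
  | mul_X p i hp =>
    rw [show polyFun (p * MvPolynomial.X i) = fun y => polyFun p y * y i by
      ext y; simp [polyFun]]
    exact hp.mul (EuclideanSpace.proj (𝕜 := ℝ) i : Euc n →L[ℝ] ℝ).contDiff

theorem contDiffAt_polyFun (p : MvPolynomial (Fin n) ℝ) (x : Euc n) :
    ContDiffAt ℝ ∞ (polyFun p) x := (contDiff_polyFun p).contDiffAt

theorem aeval_toGerm (p : MvPolynomial (Fin n) ℝ) :
    MvPolynomial.aeval (fun k => toGerm (fun y : Euc n => y k) (contDiffAt_coord k 0)) p =
      toGerm (polyFun p) (contDiffAt_polyFun p 0) := by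
  induction p using MvPolynomial.induction_on with
  | C a => 
    rw [MvPolynomial.aeval_C]
    exact (toGerm_eq_iff (f := fun _ => a) (hf := contDiffAt_const)).2
      (Filter.Eventually.of_forall fun y => by simp [polyFun])
  | add p q hp hq =>
    rw [map_add, hp, hq, toGerm_add, toGerm_eq_iff]
    exact Filter.Eventually.of_forall fun y => by simp [polyFun]
  | mul_X p i hp =>
    rw [map_mul, hp, MvPolynomial.aeval_X, toGerm_mul, toGerm_eq_iff]
    exact Filter.Eventually.of_forall fun y => by simp [polyFun]

namespace IsAdaptedFrame

theorem isAdaptedCoord (hY : IsAdaptedFrame w Y) :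
    IsAdaptedCoord (evalGerm n) (fun i => germDerivation (Y i) (hY.smooth i))
      (fun k => toGerm (fun y : Euc n => y k) (contDiffAt_coord k 0)) where
  eval k := by rw [evalGerm_toGerm]; simp
  deriv j k := by
    rw [germDerivation_toGerm, evalGerm_toGerm, vDeriv, fderiv_coord, hY.eq_single]
    simp [eq_comm]

theorem bracketCompatible (hY : IsAdaptedFrame w Y) :
    BracketCompatible (fun i => germDerivation (Y i) (hY.smooth i)) w := by
  intro i j
  obtain ⟨L, hL, hL0, h⟩ := hY.bracket i j
  refine ⟨fun k => toGerm (L k) (hL k), fun k hk => ?_, fun g => ?_⟩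
  · exact toGerm_eq_iff (g := 0) (hg := contDiffAt_const) |>.2 (hL0 k hk)
  · obtain ⟨f, hf, rfl⟩ := exists_toGerm g
    have hsum : ∑ k, toGerm (L k) (hL k) * germDerivation (Y k) (hY.smooth k) (toGerm f hf) =
        toGerm (fun y => ∑ k, L k y * vDeriv (Y k) f y)
          (ContDiffAt.sum fun k _ => (hL k).mul (contDiffAt_vDeriv (hY.smooth k) hf)) := by
      simp only [germDerivation_toGerm, toGerm_mul]
      exact sum_toGerm _ (fun k y => L k y * vDeriv (Y k) f y) _
    rw [hsum]
    simp only [germDerivation_toGerm, toGerm_sub]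
    rw [toGerm_eq_iff]
    have ev : ∀ {F : Type} [NormedAddCommGroup F] [NormedSpace ℝ F] {g : Euc n → F},
        ContDiffAt ℝ ∞ g 0 → ∀ᶠ y in 𝓝 0, ContDiffAt ℝ 2 g y := by
      intro F _ _ g hg
      exact (hg.of_le (m := 2) two_le_infty).eventually (by simp)
    filter_upwards [h, ev (hY.smooth i), ev (hY.smooth j), ev hf] with y hy h1 h2 h3
    rw [vDeriv_commutator h1 h2 h3, hy, map_sum]
    simp [vDeriv]

theorem exists_polyFun (hY : IsAdaptedFrame w Y) (hw : ∀ i, 1 ≤ w i)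
    {f : Euc n → ℝ} (hf : ContDiffAt ℝ ∞ f 0) (N : ℕ) :
    ∃ p : MvPolynomial (Fin n) ℝ, (∀ α ∈ p.support, multiWeight w α < N) ∧
      VanishesToOrder Y w N fun y => f y - polyFun p y := by
  obtain ⟨p, hp, h⟩ := exists_sub_aeval_mem_orderGE hw hY.bracketCompatible hY.isAdaptedCoord
    (toGerm f hf) N
  rw [aeval_toGerm, toGerm_sub] at h
  exact ⟨p, hp, (vanishesToOrder_iff hY.smooth _).2 h⟩

theorem eq_zero_of_vanishesToOrder (hY : IsAdaptedFrame w Y) {N : ℕ} {p : MvPolynomial (Fin n) ℝ}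
    (hp : ∀ α ∈ p.support, multiWeight w α < N) (h : VanishesToOrder Y w N (polyFun p)) :
    p = 0 := by
  refine eq_zero_of_aeval_mem_orderGE hY.isAdaptedCoord hp ?_
  rw [aeval_toGerm]
  exact (vanishesToOrder_iff hY.smooth _).1 h

theorem coeff_single (hY : IsAdaptedFrame w Y) (p : MvPolynomial (Fin n) ℝ) (j : Fin n) :
    p.coeff (Finsupp.single j 1) = vDeriv (Y j) (polyFun p) 0 := by
  rw [coeff_single_eq_eval_derivation hY.isAdaptedCoord, aeval_toGerm, germDerivation_toGerm,
    evalGerm_toGerm]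

theorem vanishesToOrder_polyFun (hY : IsAdaptedFrame w Y)
    (hx : ∀ k, VanishesToOrder Y w (w k) fun y => y k)
    {p : MvPolynomial (Fin n) ℝ} {N : ℕ} (hp : ∀ α ∈ p.support, N ≤ multiWeight w α) :
    VanishesToOrder Y w N (polyFun p) := by
  rw [vanishesToOrder_iff hY.smooth (contDiffAt_polyFun p 0), ← aeval_toGerm]
  exact aeval_mem_orderGE
    (fun k => (vanishesToOrder_iff hY.smooth (contDiffAt_coord k 0)).1 (hx k)) hp

end IsAdaptedFrame

theorem VanishesToOrder.add (hY : ∀ i, ContDiffAt ℝ ∞ (Y i) 0) {f g : Euc n → ℝ}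
    (hf : ContDiffAt ℝ ∞ f 0) (hg : ContDiffAt ℝ ∞ g 0) {N : ℕ}
    (h1 : VanishesToOrder Y w N f) (h2 : VanishesToOrder Y w N g) :
    VanishesToOrder Y w N fun y => f y + g y := by
  rw [vanishesToOrder_iff hY hf] at h1
  rw [vanishesToOrder_iff hY hg] at h2
  rw [vanishesToOrder_iff hY (hf.add hg), ← toGerm_add hf hg]
  exact Submodule.add_mem _ h1 h2

theorem VanishesToOrder.sub (hY : ∀ i, ContDiffAt ℝ ∞ (Y i) 0) {f g : Euc n → ℝ}
    (hf : ContDiffAt ℝ ∞ f 0) (hg : ContDiffAt ℝ ∞ g 0) {N : ℕ}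
    (h1 : VanishesToOrder Y w N f) (h2 : VanishesToOrder Y w N g) :
    VanishesToOrder Y w N fun y => f y - g y := by
  rw [vanishesToOrder_iff hY hf] at h1
  rw [vanishesToOrder_iff hY hg] at h2
  rw [vanishesToOrder_iff hY (hf.sub hg), ← toGerm_sub hf hg]
  exact Submodule.sub_mem _ h1 h2

theorem VanishesToOrder.of_one_weight (hw : ∀ i, 1 ≤ w i) {N : ℕ} {f : Euc n → ℝ}
    (h : VanishesToOrder Y (fun _ => 1) N f) : VanishesToOrder Y w N f := fun I hI =>
  h I (by rw [listWeight_one]; exact (length_le_listWeight hw I).trans_lt hI)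

/-- For weights 1 the bracket condition is vacuous, since `1 + 1 < 1` never holds. The algebraic
expansion then becomes the ordinary Taylor expansion, with a remainder controlled both by the
Euclidean norm and, via `VanishesToOrder.of_one_weight`, by the weighted order. -/
theorem IsAdaptedFrame.one_weight (hY : IsAdaptedFrame w Y) : IsAdaptedFrame (fun _ => 1) Y where
  smooth := hY.smooth
  eq_single := hY.eq_single
  bracket i j := by
    obtain ⟨L, hL, -, h⟩ := hY.bracket i j
    exact ⟨L, hL, fun k hk => absurd hk (by norm_num), h⟩

end Germs

end CarnotMfd

namespace CarnotMfd

open Asymptotics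

/-! ### Euclidean estimates from vanishing derivatives along a frame. -/

section Frames

variable {n : ℕ}

/-- The linear map `(a₁, …, aₙ) ↦ ∑ a_k Y_k(y)`. -/
noncomputable def frameMap (Y : Fin n → Euc n → Euc n) (y : Euc n) : Euc n →L[ℝ] Euc n :=
  ∑ k, (EuclideanSpace.proj k : Euc n →L[ℝ] ℝ).smulRight (Y k y)

theorem frameMap_apply (Y : Fin n → Euc n → Euc n) (y a : Euc n) :
    frameMap Y y a = ∑ k, a k • Y k y := by
  simp [frameMap]

theorem sum_smul_single (a : Euc n) : ∑ k, a k • EuclideanSpace.single k (1 : ℝ) = a := by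
  ext i
  simp [Pi.single_apply]

theorem contDiffAt_frameMap {Y : Fin n → Euc n → Euc n} {x : Euc n}
    (hY : ∀ i, ContDiffAt ℝ ∞ (Y i) x) : ContDiffAt ℝ ∞ (frameMap Y) x :=
  ContDiffAt.sum fun k _ =>
    (ContinuousLinearMap.smulRightL ℝ (Euc n) (Euc n)
      (EuclideanSpace.proj k : Euc n →L[ℝ] ℝ)).contDiff.contDiffAt.comp x (hY k)

/-- Near the origin, vectors are expanded with respect to a smooth frame that is standard at the
origin, with smooth coefficients. -/
theorem exists_frame_coeff {Y : Fin n → Euc n → Euc n} (hY : ∀ i, ContDiffAt ℝ ∞ (Y i) 0)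
    (h0 : ∀ j, Y j 0 = EuclideanSpace.single j (1 : ℝ)) :
    ∃ c : Euc n → Euc n →L[ℝ] Euc n, ContDiffAt ℝ ∞ c 0 ∧
      ∀ᶠ y in 𝓝 0, (∀ v, ∑ k, c y v k • Y k y = v) ∧
        ∀ a : Euc n, c y (∑ k, a k • Y k y) = a := by
  have hid : frameMap Y 0 = (ContinuousLinearEquiv.refl ℝ (Euc n) : Euc n →L[ℝ] Euc n) := by
    ext1 a
    rw [frameMap_apply]
    simp only [h0, sum_smul_single]
    rfl
  have hsm := contDiffAt_frameMap hY
  refine ⟨fun y => (frameMap Y y).inverse, ?_, ?_⟩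
  · have := contDiffAt_map_inverse (𝕜 := ℝ) (n := ∞) (ContinuousLinearEquiv.refl ℝ (Euc n))
    rw [← hid] at this
    exact this.comp 0 hsm
  · have hnear : ∀ᶠ y in 𝓝 (0 : Euc n), frameMap Y y ∈
        Set.range ((↑) : (Euc n ≃L[ℝ] Euc n) → Euc n →L[ℝ] Euc n) := by
      refine hsm.continuousAt.eventually ?_
      rw [hid]
      exact ContinuousLinearEquiv.nhds _
    filter_upwards [hnear] with y ⟨e, he⟩
    refine ⟨fun v => ?_, fun a => ?_⟩
    · rw [← frameMap_apply, ← he, ContinuousLinearMap.inverse_equiv]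
      simp
    · rw [← frameMap_apply, ← he, ContinuousLinearMap.inverse_equiv]
      simp

/-- Each `Y i f` vanishes to one order less. The frame spans, so the full differential is O(‖y‖^K)
by induction, and the mean value inequality on the closed ball of radius ‖y‖ gains one power. -/
theorem isBigO_norm_pow_of_vanishesToOrder {Y : Fin n → Euc n → Euc n}
    (hY : ∀ i, ContDiffAt ℝ ∞ (Y i) 0) (h0 : ∀ j, Y j 0 = EuclideanSpace.single j (1 : ℝ))
    (K : ℕ) {f : Euc n → ℝ} (hf : ContDiffAt ℝ ∞ f 0)
    (h : VanishesToOrder Y (fun _ => 1) K f) : f =O[𝓝 0] fun y => ‖y‖ ^ K := by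
  induction K generalizing f with
  | zero =>
    simp only [pow_zero]
    exact hf.continuousAt.tendsto.isBigO_one ℝ
  | succ K ih =>
    obtain ⟨c, hc, hcY⟩ := exists_frame_coeff hY h0
    have hYf : ∀ i, vDeriv (Y i) f =O[𝓝 0] fun y => ‖y‖ ^ K := fun i =>
      ih (contDiffAt_vDeriv (hY i) hf) fun I hI => by
        rw [← iterVDeriv_append_singleton]
        refine h _ ?_
        rw [listWeight_append, listWeight_cons, listWeight_nil]
        omega
    have hfd : fderiv ℝ f =O[𝓝 0] fun y => ‖y‖ ^ K := by
      have e : fderiv ℝ f =ᶠ[𝓝 0] fun y =>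
          ∑ k, vDeriv (Y k) f y • ((EuclideanSpace.proj k : Euc n →L[ℝ] ℝ).comp (c y)) := by
        filter_upwards [hcY] with y hy
        ext1 v
        conv_lhs => rw [← hy.1 v, map_sum]
        simp [vDeriv, mul_comm]
      refine e.trans_isBigO (IsBigO.fun_sum fun k _ => ?_)
      have hb : (fun y => (EuclideanSpace.proj k : Euc n →L[ℝ] ℝ).comp (c y)) =O[𝓝 0]
          fun _ => (1 : ℝ) :=
        ((continuousAt_const.clm_comp hc.continuousAt).tendsto).isBigO_one ℝ
      simpa using (hYf k).smul hb
    obtain ⟨C, hC⟩ := hfd.bound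
    obtain ⟨ε, hε, hball⟩ := Metric.eventually_nhds_iff_ball.1
      (hC.and (eventually_differentiableAt hf))
    have hf0 : f 0 = 0 := h [] (by rw [listWeight_nil]; omega)
    refine IsBigO.of_bound C ?_
    filter_upwards [Metric.ball_mem_nhds 0 hε] with y hy
    have hy' : ‖y‖ < ε := by simpa using hy
    have hsub : ∀ z ∈ Metric.closedBall (0 : Euc n) ‖y‖, z ∈ Metric.ball (0 : Euc n) ε := by
      intro z hz
      rw [mem_closedBall_zero_iff] at hz
      rw [mem_ball_zero_iff]
      exact hz.trans_lt hy'
    -- The mean value bound needs monotonicity in the radius, hence `0 ≤ C`; the bound at a nonzero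
    -- `y` forces it.
    have hC0 : 0 ≤ C ∨ ‖y‖ = 0 := by
      by_cases hy0 : ‖y‖ = 0
      · exact Or.inr hy0
      · left
        have h1 := (hball y hy).1
        have h2 : 0 < ‖‖y‖ ^ K‖ := by
          rw [norm_pow, norm_norm]; exact pow_pos ((norm_nonneg y).lt_of_ne' hy0) _
        exact nonneg_of_mul_nonneg_left ((norm_nonneg _).trans h1) h2
    rcases hC0 with hC0 | hy0
    · have := (convex_closedBall (0 : Euc n) ‖y‖).norm_image_sub_le_of_norm_fderiv_le (𝕜 := ℝ)
        (f := f) (C := C * ‖y‖ ^ K) (x := 0) (y := y)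
        (fun z hz => (hball z (hsub z hz)).2) (fun z hz => ?_) (by simp) (by simp)
      · rw [hf0, sub_zero, sub_zero] at this
        rw [norm_pow, norm_norm, pow_succ, ← mul_assoc]
        exact this
      · refine ((hball z (hsub z hz)).1).trans ?_
        rw [norm_pow, norm_norm]
        gcongr
        simpa using hz
    · rw [norm_eq_zero.1 hy0, hf0]
      simp

end Frames

/-! ### Comparison of coordinates and polynomials with the pseudo-norm. -/

section PseudoNorm

variable {n : ℕ} {w : Fin n → ℕ} {N : Euc n → ℝ}

theorem dilation_apply (t : ℝ) (x : Euc n) (k : Fin n) : dilation w t x k = t ^ w k * x k := rfl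

theorem dilation_zero (hw : ∀ i, 1 ≤ w i) (x : Euc n) : dilation w 0 x = 0 := by
  ext k
  rw [dilation_apply, zero_pow (by have := hw k; omega), zero_mul]
  rfl

theorem dilation_one (x : Euc n) : dilation w 1 x = x := by
  ext k
  simp [dilation_apply]

theorem dilation_dilation (s t : ℝ) (x : Euc n) :
    dilation w s (dilation w t x) = dilation w (s * t) x := by
  ext k
  simp [dilation_apply, mul_pow, mul_assoc]

theorem continuous_dilation (x : Euc n) : Continuous fun t => dilation w t x := by
  unfold dilation
  fun_prop

namespace IsPseudoNorm

theorem zero (hN : IsPseudoNorm w N) (hw : ∀ i, 1 ≤ w i) : N 0 = 0 := by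
  have := hN.dilation 0 0
  rwa [dilation_zero hw, abs_zero, zero_mul] at this

theorem exists_abs_coord_le (hN : IsPseudoNorm w N) (hw : ∀ i, 1 ≤ w i) (k : Fin n) :
    ∃ C, ∀ x : Euc n, |x k| ≤ C * N x ^ w k := by
  -- `c` is a positive lower bound of `N` on the Euclidean unit sphere. A point `y` with `N y = 1`
  -- outside the unit ball is dilated back to the sphere by some `t ≤ 1`; there `c ≤ t` and t^{w_k}
  -- |y_k| ≤ 1, which bounds y_k. Homogeneity extends the bound to all points.
  obtain ⟨c, hc, hcN⟩ := (isCompact_sphere (0 : Euc n) 1).exists_forall_le'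
    hN.continuous.continuousOn (a := 0)
    (fun x hx => hN.pos x (ne_zero_of_mem_unit_sphere ⟨x, hx⟩))
  have habs : ∀ x : Euc n, |x k| ≤ ‖x‖ := fun x => by
    simpa using EuclideanSpace.norm_eq x ▸ PiLp.norm_apply_le x k
  have hunit : ∀ y : Euc n, N y = 1 → |y k| ≤ max 1 ((c ^ w k)⁻¹) := by
    intro y hy
    by_cases h1 : ‖y‖ ≤ 1
    · exact le_max_of_le_left ((habs y).trans h1)
    · have hivt : (1 : ℝ) ∈ (fun t => ‖CarnotMfd.dilation w t y‖) '' Set.Icc 0 1 := by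
        refine intermediate_value_Icc zero_le_one (continuous_dilation y).norm.continuousOn ⟨?_, ?_⟩
        · simp [dilation_zero hw]
        · simp only [dilation_one]; exact (not_le.1 h1).le
      obtain ⟨t, ht, ht1⟩ := hivt
      have h2 := hcN (CarnotMfd.dilation w t y) (by simpa using ht1)
      rw [hN.dilation, hy, mul_one, abs_of_nonneg ht.1] at h2
      have h3 := (habs (CarnotMfd.dilation w t y)).trans ht1.le
      rw [dilation_apply, abs_mul, abs_of_nonneg (pow_nonneg ht.1 _)] at h3
      have h4 : c ^ w k * |y k| ≤ 1 :=
        (mul_le_mul_of_nonneg_right (pow_le_pow_left₀ hc.le h2 _) (abs_nonneg _)).trans h3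
      refine le_max_of_le_right ?_
      rwa [← one_div, le_div_iff₀ (pow_pos hc _), mul_comm]
  refine ⟨max 1 ((c ^ w k)⁻¹), fun x => ?_⟩
  by_cases hx : x = 0
  · subst hx
    rw [hN.zero hw, zero_pow (by have := hw k; omega)]
    simp
  · have hpos := hN.pos x hx
    have h1 := hunit (CarnotMfd.dilation w (N x)⁻¹ x) (by
      rw [hN.dilation, abs_of_pos (inv_pos.2 hpos), inv_mul_cancel₀ hpos.ne'])
    rw [dilation_apply, abs_mul, inv_pow, abs_of_pos (inv_pos.2 (pow_pos hpos _)),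
      inv_mul_le_iff₀ (pow_pos hpos _)] at h1
    rw [mul_comm]
    exact h1

theorem isBigO_coord (hN : IsPseudoNorm w N) (hw : ∀ i, 1 ≤ w i) (k : Fin n) :
    (fun x : Euc n => x k) =O[𝓝 0] fun x => N x ^ w k := by
  obtain ⟨C, hC⟩ := hN.exists_abs_coord_le hw k
  refine IsBigO.of_bound C (Filter.Eventually.of_forall fun x => ?_)
  rw [Real.norm_eq_abs, Real.norm_eq_abs, abs_of_nonneg (pow_nonneg (hN.nonneg x) _)]
  exact hC x

theorem isBigO_pow (hN : IsPseudoNorm w N) {a b : ℕ} (hab : a ≤ b) :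
    (fun x => N x ^ b) =O[𝓝 0] fun x => N x ^ a := by
  have h : (fun x => N x ^ (b - a)) =O[𝓝 0] fun _ => (1 : ℝ) :=
    ((hN.continuous.pow _).tendsto 0).isBigO_one ℝ
  have := (isBigO_refl (fun x => N x ^ a) (𝓝 0)).mul h
  simpa [← pow_add, Nat.add_sub_cancel' hab] using this

theorem isBigO_norm (hN : IsPseudoNorm w N) (hw : ∀ i, 1 ≤ w i) :
    (fun x : Euc n => ‖x‖) =O[𝓝 0] N := by
  have h1 : (fun x : Euc n => ∑ k, x k • EuclideanSpace.single k (1 : ℝ)) =O[𝓝 0] N := by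
    refine IsBigO.fun_sum fun k _ => ?_
    have h2 := (hN.isBigO_coord hw k).trans (hN.isBigO_pow (hw k))
    have h3 := h2.smul (isBigO_refl (fun _ : Euc n => EuclideanSpace.single k (1 : ℝ)) (𝓝 0))
    simp only [pow_one] at h3
    refine h3.trans (IsBigO.of_bound 1 (Filter.Eventually.of_forall fun x => ?_))
    rw [norm_smul, PiLp.norm_single, norm_one, mul_one, one_mul]
  simp only [sum_smul_single] at h1
  exact h1.norm_left

theorem isBigO_polyFun (hN : IsPseudoNorm w N) (hw : ∀ i, 1 ≤ w i)
    {p : MvPolynomial (Fin n) ℝ} {m : ℕ} (hp : ∀ α ∈ p.support, m ≤ multiWeight w α) :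
    polyFun p =O[𝓝 0] fun x => N x ^ m := by
  have e : polyFun p = fun x => ∑ α ∈ p.support, p.coeff α * ∏ i, x i ^ α i := by
    ext x; exact MvPolynomial.eval_eq' _ _
  rw [e]
  refine IsBigO.fun_sum fun α hα => IsBigO.const_mul_left ?_ _
  refine IsBigO.trans ?_ (hN.isBigO_pow (hp α hα))
  have := IsBigO.finsetProd (s := Finset.univ) (l := 𝓝 (0 : Euc n))
    (f := fun (i : Fin n) (x : Euc n) => x i ^ α i) (g := fun i x => (N x ^ w i) ^ α i)
    fun i _ => (hN.isBigO_coord hw i).pow _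
  refine this.congr_right fun x => ?_
  simp only [← pow_mul, Finset.prod_pow_eq_pow_sum, multiWeight]

end IsPseudoNorm

/-- Dividing by the largest power of the variable leaves a polynomial with nonzero value at 0 that
would have to tend to 0. -/
theorem polynomial_eq_zero_of_isBigO {Q : Polynomial ℝ} {m : ℕ} (hdeg : Q.degree < m)
    (h : (fun s => Q.eval s) =O[𝓝 0] fun s => s ^ m) : Q = 0 := by
  by_contra hQ
  obtain ⟨R, hR, hdvd⟩ := Polynomial.exists_eq_pow_rootMultiplicity_mul_and_not_dvd Q hQ 0
  set k := Q.rootMultiplicity 0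
  rw [map_zero, sub_zero] at hR hdvd
  have hR0 : R.eval 0 ≠ 0 := by
    rw [← Polynomial.coeff_zero_eq_eval_zero]
    exact fun hc => hdvd (Polynomial.X_dvd_iff.2 hc)
  have hkm : k < m := by
    have h1 : k ≤ Q.natDegree := by
      rw [hR, Polynomial.natDegree_mul (pow_ne_zero _ Polynomial.X_ne_zero)
        (fun hc => hR0 (by rw [hc, Polynomial.eval_zero])), Polynomial.natDegree_X_pow]
      omega
    exact h1.trans_lt ((Polynomial.natDegree_lt_iff_degree_lt hQ).2 hdeg)
  have h2 : (fun s => R.eval s) =O[𝓝[≠] 0] fun s : ℝ => s ^ (m - k) := by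
    obtain ⟨C, hC⟩ := h.bound
    refine IsBigO.of_bound C ?_
    filter_upwards [nhdsWithin_le_nhds hC, self_mem_nhdsWithin] with s hs hs0
    have hspos : 0 < ‖s‖ ^ k := pow_pos (norm_pos_iff.2 hs0) _
    rw [hR] at hs
    simp only [Polynomial.eval_mul, Polynomial.eval_pow, Polynomial.eval_X, norm_mul,
      norm_pow] at hs
    rw [show m = k + (m - k) by omega, pow_add] at hs
    rw [norm_pow]
    refine le_of_mul_le_mul_left (hs.trans_eq ?_) hspos
    ring
  have h3 : Filter.Tendsto (fun s : ℝ => s ^ (m - k)) (𝓝[≠] 0) (𝓝 0) := by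
    have : Filter.Tendsto (fun s : ℝ => s ^ (m - k)) (𝓝 0) (𝓝 (0 ^ (m - k))) :=
      (continuous_pow (m - k)).tendsto 0
    rw [zero_pow (by omega)] at this
    exact this.mono_left nhdsWithin_le_nhds
  have h4 : Filter.Tendsto (fun s => R.eval s) (𝓝[≠] 0) (𝓝 (R.eval 0)) :=
    (R.continuous.tendsto 0).mono_left nhdsWithin_le_nhds
  exact hR0 (tendsto_nhds_unique h4 (h2.trans_tendsto h3))

theorem polyFun_eq_zero_of_isBigO (hN : IsPseudoNorm w N) (hw : ∀ i, 1 ≤ w i)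
    {p : MvPolynomial (Fin n) ℝ} {m : ℕ} (hp : ∀ α ∈ p.support, multiWeight w α < m)
    (h : polyFun p =O[𝓝 0] fun x => N x ^ m) (x : Euc n) : polyFun p x = 0 := by
  -- `Q` is `p` restricted to the curve s ↦ s · x. Its degree is `< m`, yet it is O(s^m); evaluation
  -- at s = 1 recovers `p` at `x`.
  set Q : Polynomial ℝ := ∑ α ∈ p.support,
    Polynomial.monomial (multiWeight w α) (p.coeff α * ∏ i, x i ^ α i) with hQ
  have hQe : ∀ s, Q.eval s = polyFun p (dilation w s x) := by
    intro s
    rw [hQ, Polynomial.eval_finsetSum, polyFun, MvPolynomial.eval_eq']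
    refine Finset.sum_congr rfl fun α _ => ?_
    simp only [Polynomial.eval_monomial, dilation_apply, mul_pow, Finset.prod_mul_distrib,
      ← pow_mul, Finset.prod_pow_eq_pow_sum, multiWeight]
    ring
  have hQ0 : Q = 0 := by
    refine polynomial_eq_zero_of_isBigO (m := m) ?_ ?_
    · rw [hQ, ← Polynomial.mem_degreeLT]
      refine Submodule.sum_mem _ fun α hα => ?_
      rw [Polynomial.mem_degreeLT]
      exact (Polynomial.degree_monomial_le _ _).trans_lt (by exact_mod_cast hp α hα)
    · have ht : Filter.Tendsto (fun s => dilation w s x) (𝓝 0) (𝓝 0) := by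
        have := (continuous_dilation (w := w) x).tendsto 0
        rwa [dilation_zero hw] at this
      have h1 := h.comp_tendsto ht
      refine IsBigO.trans (h1.congr_left fun s => (hQe s).symm) ?_
      refine IsBigO.of_bound (N x ^ m) (Filter.Eventually.of_forall fun s => ?_)
      simp only [Function.comp_apply, hN.dilation, mul_pow, norm_mul, norm_pow, Real.norm_eq_abs,
        abs_abs, abs_of_nonneg (hN.nonneg x)]
      rw [mul_comm]
  have := hQe 1
  rwa [hQ0, Polynomial.eval_zero, dilation_one, eq_comm] at this

end PseudoNorm

/-! ### Weighted order versus growth in privileged coordinates. -/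

section Privileged

variable {n : ℕ} {w : Fin n → ℕ} {N : Euc n → ℝ} {Y : Fin n → Euc n → Euc n}

theorem exists_add_weight_lt_le (w : Fin n → ℕ) (p : MvPolynomial (Fin n) ℝ) (m : ℕ) :
    ∃ p₁ p₂ : MvPolynomial (Fin n) ℝ, p = p₁ + p₂ ∧
      (∀ α ∈ p₁.support, α ∈ p.support ∧ multiWeight w α < m) ∧
      ∀ α ∈ p₂.support, m ≤ multiWeight w α := by
  classical
  have hs : ∀ (s : Finset (Fin n →₀ ℕ)) α,
      α ∈ (∑ β ∈ s, MvPolynomial.monomial β (p.coeff β)).support → α ∈ s := by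
    intro s α hα
    obtain ⟨β, hβ, h⟩ := Finset.mem_biUnion.1 (MvPolynomial.support_sum hα)
    rwa [Finset.mem_singleton.1 (MvPolynomial.support_monomial_subset h)]
  refine ⟨∑ α ∈ p.support with multiWeight w α < m, MvPolynomial.monomial α (p.coeff α),
    ∑ α ∈ p.support with ¬ multiWeight w α < m, MvPolynomial.monomial α (p.coeff α), ?_, ?_, ?_⟩
  · rw [Finset.sum_filter_add_sum_filter_not]
    exact p.as_sum
  · exact fun α hα => Finset.mem_filter.1 (hs _ α hα)
  · exact fun α hα => not_lt.1 (Finset.mem_filter.1 (hs _ α hα)).2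

theorem polyFun_add (p q : MvPolynomial (Fin n) ℝ) (y : Euc n) :
    polyFun (p + q) y = polyFun p y + polyFun q y := by simp [polyFun]

/-- In privileged coordinates, a smooth function that is `O(‖x‖^m)` has order at least `m`. -/
theorem IsAdaptedFrame.vanishesToOrder_of_isBigO (hY : IsAdaptedFrame w Y) (hw : ∀ i, 1 ≤ w i)
    (hN : IsPseudoNorm w N) (hx : ∀ k, VanishesToOrder Y w (w k) fun y => y k) {m : ℕ}
    {f : Euc n → ℝ} (hf : ContDiffAt ℝ ∞ f 0) (h : f =O[𝓝 0] fun x => N x ^ m) :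
    VanishesToOrder Y w m f := by
  obtain ⟨p, -, hR⟩ := hY.one_weight.exists_polyFun (fun _ => le_rfl) hf m
  have hRs := hf.sub (contDiffAt_polyFun p 0)
  have hRO := (isBigO_norm_pow_of_vanishesToOrder hY.smooth hY.eq_single m hRs hR).trans
    ((hN.isBigO_norm hw).pow m)
  obtain ⟨p₁, p₂, rfl, hp₁, hp₂⟩ := exists_add_weight_lt_le w p m
  -- The light part `p₁` of the isotropic Taylor polynomial is a difference of O(N^m) terms and
  -- hence vanishes; the heavy part and the remainder both have order at least `m`.
  have h1 : polyFun p₁ =O[𝓝 0] fun x => N x ^ m := by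
    refine ((h.sub hRO).sub (hN.isBigO_polyFun hw hp₂)).congr_left fun x => ?_
    simp only [polyFun_add]
    ring
  have h2 := polyFun_eq_zero_of_isBigO hN hw (fun α hα => (hp₁ α hα).2) h1
  have h3 := (hR.of_one_weight hw).add hY.smooth hRs (contDiffAt_polyFun p₂ 0)
    (hY.vanishesToOrder_polyFun hx hp₂)
  convert h3 using 2 with x
  rw [polyFun_add, h2]
  ring

/-- In privileged coordinates, a smooth function of order at least `m` is, up to `O(‖x‖^{m+1})`,
a homogeneous polynomial of weight `m`. -/
theorem IsAdaptedFrame.exists_homogeneous_approx (hY : IsAdaptedFrame w Y) (hw : ∀ i, 1 ≤ w i)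
    (hN : IsPseudoNorm w N) (hx : ∀ k, VanishesToOrder Y w (w k) fun y => y k) {m : ℕ}
    {f : Euc n → ℝ} (hf : ContDiffAt ℝ ∞ f 0) (h : VanishesToOrder Y w m f) :
    ∃ p : MvPolynomial (Fin n) ℝ, (∀ α ∈ p.support, multiWeight w α = m) ∧
      (fun x => f x - polyFun p x) =O[𝓝 0] (fun x => N x ^ (m + 1)) ∧
      ∀ j, w j = m → p.coeff (Finsupp.single j 1) = vDeriv (Y j) f 0 := by
  obtain ⟨p, -, hR⟩ := hY.one_weight.exists_polyFun (fun _ => le_rfl) hf (m + 1)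
  have hRs := hf.sub (contDiffAt_polyFun p 0)
  have hRO := (isBigO_norm_pow_of_vanishesToOrder hY.smooth hY.eq_single _ hRs hR).trans
    ((hN.isBigO_norm hw).pow (m + 1))
  have hcoeff : ∀ j, w j = m → p.coeff (Finsupp.single j 1) = vDeriv (Y j) f 0 := by
    intro j hj
    have h1 : vDeriv (Y j) (fun y => f y - polyFun p y) 0 = 0 := hR [j] (by
      rw [listWeight_one, List.length_singleton]; have := hw j; omega)
    have h0 : (∞ : WithTop ℕ∞) ≠ 0 := by simp
    rw [vDeriv, fderiv_fun_sub (hf.differentiableAt h0)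
      ((contDiffAt_polyFun p 0).differentiableAt h0)] at h1
    rw [hY.coeff_single, vDeriv, vDeriv]
    exact (sub_eq_zero.1 h1).symm
  obtain ⟨p₁, p₂, rfl, hp₁, hp₂⟩ := exists_add_weight_lt_le w p m
  have hRm : VanishesToOrder Y w m fun y => f y - polyFun (p₁ + p₂) y := fun I hI =>
    hR.of_one_weight hw I (by omega)
  -- Here `p₁` has order at least `m`, since `f`, the remainder and the heavy part do, while all its
  -- weights are `< m`.
  have hp₁0 : p₁ = 0 := by
    refine hY.eq_zero_of_vanishesToOrder (fun α hα => (hp₁ α hα).2) ?_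
    have h3 := (h.sub hY.smooth hf hRs hRm).sub hY.smooth (hf.sub hRs)
      (contDiffAt_polyFun p₂ 0) (hY.vanishesToOrder_polyFun hx hp₂)
    convert h3 using 2 with x
    rw [polyFun_add]
    ring
  subst hp₁0
  rw [zero_add] at hcoeff hRO
  -- Cutting again at `m + 1` leaves exactly weight `m` in `p₃`; `p₄` is absorbed by the error.
  obtain ⟨p₃, p₄, rfl, hp₃, hp₄⟩ := exists_add_weight_lt_le w p₂ (m + 1)
  refine ⟨p₃, fun α hα => ?_, ?_, fun j hj => ?_⟩
  · have h1 := hp₃ α hα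
    have h2 := hp₂ α h1.1
    omega
  · refine (hRO.add (hN.isBigO_polyFun hw hp₄)).congr_left fun x => ?_
    simp only [polyFun_add]
    ring
  · rw [← hcoeff j hj, MvPolynomial.coeff_add]
    have : p₄.coeff (Finsupp.single j 1) = 0 := by
      rw [← MvPolynomial.notMem_support_iff]
      intro hc
      have := hp₄ _ hc
      rw [multiWeight_single] at this
      omega
    rw [this, add_zero]

end Privileged

end CarnotMfd

namespace CarnotMfd

/-! ### Triangular and homogeneous polynomial diffeomorphisms. -/

section PolynomialMaps

open MvPolynomial

variable {n : ℕ} {w : Fin n → ℕ}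

/-- The polynomial map of `ℝⁿ` with the components `q k`. -/
noncomputable def polyMap (q : Fin n → MvPolynomial (Fin n) ℝ) (x : Euc n) : Euc n :=
  WithLp.toLp 2 fun k => polyFun (q k) x

theorem polyMap_apply (q : Fin n → MvPolynomial (Fin n) ℝ) (x : Euc n) (k : Fin n) :
    polyMap q x k = polyFun (q k) x := rfl

theorem polyFun_X (k : Fin n) (x : Euc n) : polyFun (X k) x = x k := by simp [polyFun]

theorem polyFun_sub (p q : MvPolynomial (Fin n) ℝ) (y : Euc n) :
    polyFun (p - q) y = polyFun p y - polyFun q y := by simp [polyFun]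

theorem polyFun_zero_right (p : MvPolynomial (Fin n) ℝ) : polyFun p 0 = p.coeff 0 := by
  simp [polyFun, ← constantCoeff_eq, ← MvPolynomial.eval_zero]

theorem contDiff_polyMap (q : Fin n → MvPolynomial (Fin n) ℝ) : ContDiff ℝ ∞ (polyMap q) :=
  contDiff_euclidean.2 fun k => contDiff_polyFun (q k)

theorem isAdaptedFrame_const :
    IsAdaptedFrame w fun (j : Fin n) (_ : Euc n) => EuclideanSpace.single j (1 : ℝ) where
  smooth _ := contDiffAt_const
  eq_single _ := rfl
  bracket i j := ⟨fun _ _ => 0, fun _ => contDiffAt_const, fun _ _ => Filter.EventuallyEq.rfl,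
    Filter.Eventually.of_forall fun y => by simp [VectorField.lieBracket]⟩

theorem fderiv_polyFun_zero (p : MvPolynomial (Fin n) ℝ) (j : Fin n) :
    fderiv ℝ (polyFun p) 0 (EuclideanSpace.single j (1 : ℝ)) = p.coeff (Finsupp.single j 1) :=
  ((isAdaptedFrame_const (w := fun _ : Fin n => 1)).coeff_single p j).symm

theorem hasFDerivAt_polyMap_zero {q : Fin n → MvPolynomial (Fin n) ℝ}
    (hq : ∀ j k, (q k).coeff (Finsupp.single j 1) = if j = k then 1 else 0) :
    HasFDerivAt (polyMap q) (ContinuousLinearMap.id ℝ (Euc n)) 0 := by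
  rw [← hasFDerivWithinAt_univ, hasFDerivWithinAt_euclidean]
  intro k
  have h1 : HasFDerivAt (polyFun (q k)) (fderiv ℝ (polyFun (q k)) 0) 0 :=
    ((contDiff_polyFun (q k)).differentiable (by simp)).differentiableAt.hasFDerivAt
  rw [hasFDerivWithinAt_univ]
  refine h1.congr_fderiv ?_
  ext v
  rw [← sum_smul_single v, map_sum, map_sum]
  refine Finset.sum_congr rfl fun j _ => ?_
  rw [map_smul, map_smul, fderiv_polyFun_zero, hq]
  simp [eq_comm]

theorem polyFun_dilation {p : MvPolynomial (Fin n) ℝ} {m : ℕ}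
    (hp : ∀ α ∈ p.support, multiWeight w α = m) (t : ℝ) (x : Euc n) :
    polyFun p (dilation w t x) = t ^ m * polyFun p x := by
  rw [polyFun, polyFun, eval_eq', eval_eq', Finset.mul_sum]
  refine Finset.sum_congr rfl fun α hα => ?_
  simp only [dilation_apply, mul_pow, Finset.prod_mul_distrib, ← pow_mul,
    Finset.prod_pow_eq_pow_sum]
  rw [show ∑ i, w i * α i = m from hp α hα]
  ring

/-- A polynomial map `x ↦ x + P(x)`, where `P_k` depends only on the variables `x_i` with
`w_i < w_k`, is a diffeomorphism. -/
theorem exists_diffeomorph_triangular (w : Fin n → ℕ) (P : Fin n → MvPolynomial (Fin n) ℝ)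
    (hP : ∀ k, ∀ α ∈ (P k).support, ∀ i, α i ≠ 0 → w i < w k) :
    ∃ Φ : Diffeomorph 𝓘(ℝ, Euc n) 𝓘(ℝ, Euc n) (Euc n) (Euc n) ∞,
      ∀ x, Φ x = x + polyMap P x := by
  have hdep : ∀ k (x y : Euc n), (∀ i, w i < w k → x i = y i) →
      polyMap P x k = polyMap P y k := by
    intro k x y h
    rw [polyMap_apply, polyMap_apply, polyFun, polyFun, eval_eq', eval_eq']
    refine Finset.sum_congr rfl fun α hα => ?_
    congr 1
    refine Finset.prod_congr rfl fun i _ => ?_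
    by_cases hi : α i = 0
    · rw [hi, pow_zero, pow_zero]
    · rw [h i (hP k α hα i hi)]
  -- The inverse solves z = y - P(z). Since P_k involves only variables of smaller weight,
  -- coordinate `k` of this iteration is final once `m > w k`, so finitely many steps give a smooth
  -- exact inverse.
  let G : ℕ → Euc n → Euc n := fun m y => (fun z => y - polyMap P z)^[m] y
  have hG : ∀ m y, G (m + 1) y = y - polyMap P (G m y) := fun m y =>
    Function.iterate_succ_apply' _ _ _
  have hleft : ∀ m k x, w k < m → G m (x + polyMap P x) k = x k := by
    intro m
    induction m with
    | zero => intro k x h; exact absurd h (Nat.not_lt_zero _)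
    | succ m ih =>
      intro k x h
      rw [hG, PiLp.sub_apply, PiLp.add_apply,
        hdep k (G m (x + polyMap P x)) x fun i hi => ih i x (by omega)]
      ring
  have hstab : ∀ m k y, w k < m → G (m + 1) y k = G m y k := by
    intro m
    induction m with
    | zero => intro k x h; exact absurd h (Nat.not_lt_zero _)
    | succ m ih =>
      intro k y h
      rw [hG (m + 1), hG m, PiLp.sub_apply, PiLp.sub_apply, ← hG m,
        hdep k _ _ fun i hi => ih i y (by omega)]
  have hsm : ∀ m, ContDiff ℝ ∞ (G m) := by
    intro m
    induction m with
    | zero => exact contDiff_id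
    | succ m ih =>
      rw [show G (m + 1) = fun y => y - polyMap P (G m y) from funext (hG m)]
      exact contDiff_id.sub ((contDiff_polyMap P).comp ih)
  set R := Finset.univ.sup w + 1
  have hR : ∀ k, w k < R := fun k =>
    Nat.lt_succ_of_le (Finset.le_sup (f := w) (Finset.mem_univ k))
  refine ⟨{ toFun := fun x => x + polyMap P x
            invFun := G R
            left_inv := fun x => by ext k; exact hleft R k x (hR k)
            right_inv := fun y => ?_
            contMDiff_toFun := (contDiff_id.add (contDiff_polyMap P)).contMDiff
            contMDiff_invFun := (hsm R).contMDiff }, fun x => rfl⟩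
  have h1 : G (R + 1) y = G R y := by ext k; exact hstab R k y (hR k)
  rw [hG] at h1
  change G R y + polyMap P (G R y) = y
  nth_rewrite 1 [← h1]
  exact sub_add_cancel _ _

theorem le_multiWeight {α : Fin n →₀ ℕ} {i : Fin n} (hi : α i ≠ 0) : w i ≤ multiWeight w α :=
  (Nat.le_mul_of_pos_right _ (Nat.pos_of_ne_zero hi)).trans (mul_le_multiWeight w α i)

theorem IsTriangularPoly.exists_diffeomorph {f : Euc n → Euc n} (hf : IsTriangularPoly w f) :
    ∃ Φ : Diffeomorph 𝓘(ℝ, Euc n) 𝓘(ℝ, Euc n) (Euc n) (Euc n) ∞, ⇑Φ = f := by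
  obtain ⟨P, hP, hPf⟩ := hf
  obtain ⟨Φ, hΦ⟩ := exists_diffeomorph_triangular w P fun k α hα i hi =>
    (le_multiWeight hi).trans_lt (hP k α hα).1
  refine ⟨Φ, ?_⟩
  ext x k
  rw [hΦ, hPf]
  rfl

theorem IsTriangularPoly.hasFDerivAt_zero {f : Euc n → Euc n} (hf : IsTriangularPoly w f) :
    f 0 = 0 ∧ HasFDerivAt f (ContinuousLinearMap.id ℝ (Euc n)) 0 := by
  obtain ⟨P, hP, hPf⟩ := hf
  have e : f = polyMap fun k => X k + P k := by
    ext x k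
    rw [hPf, polyMap_apply, polyFun_add, polyFun_X]
    rfl
  have hc : ∀ k (α : Fin n →₀ ℕ), multiLength α < 2 → (P k).coeff α = 0 := by
    intro k α hα
    by_contra hc
    have := (hP k α (mem_support_iff.2 hc)).2
    omega
  rw [e]
  refine ⟨?_, hasFDerivAt_polyMap_zero fun j k => ?_⟩
  · ext k
    rw [polyMap_apply, polyFun_zero_right, coeff_add, coeff_zero_X,
      hc k 0 (by simp [multiLength])]
    simp
  · rw [coeff_add, hc k _ (by rw [← multiWeight_one, multiWeight_single]; norm_num), coeff_X,
      add_zero]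
    simp [Finsupp.single_left_inj, eq_comm]

/-- Polynomials `q_k` that are homogeneous of weight `w_k`, with linear part `x_k`, are the
components of a diffeomorphism. -/
theorem exists_diffeomorph_homogeneous (hw : ∀ i, 1 ≤ w i) {q : Fin n → MvPolynomial (Fin n) ℝ}
    (hq : ∀ k, ∀ α ∈ (q k).support, multiWeight w α = w k)
    (hq1 : ∀ j k, w j = w k → (q k).coeff (Finsupp.single j 1) = if j = k then 1 else 0) :
    ∃ Φ : Diffeomorph 𝓘(ℝ, Euc n) 𝓘(ℝ, Euc n) (Euc n) (Euc n) ∞, ⇑Φ = polyMap q ∧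
      IsPolynomialMap Φ ∧ IsWHomogeneous w Φ ∧
      HasFDerivAt Φ (ContinuousLinearMap.id ℝ (Euc n)) 0 := by
  obtain ⟨Φ, hΦ⟩ := exists_diffeomorph_triangular w (fun k => q k - X k) (by
    intro k α hα i hi
    by_contra! hik
    have hαw : multiWeight w α = w k := by
      by_cases h1 : α ∈ (q k).support
      · exact hq k α h1
      · rw [mem_support_iff, coeff_sub, notMem_support_iff.1 h1, zero_sub, neg_ne_zero,
          ← mem_support_iff, support_X, Finset.mem_singleton] at hα
        rw [hα, multiWeight_single, mul_one]
    have hsplit : α = Finsupp.single i 1 + (α - Finsupp.single i 1) := by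
      rw [add_tsub_cancel_of_le]
      rwa [Finsupp.single_le_iff, Nat.one_le_iff_ne_zero]
    -- A monomial of weight w_k containing a variable with w_i ≥ w_k can only be x_i itself, and
    -- `hq1` excludes it from q_k - x_k.
    have h2 : multiWeight w (α - Finsupp.single i 1) = 0 ∧ w i = w k := by
      rw [hsplit, multiWeight_add, multiWeight_single] at hαw
      omega
    have h3 : α - Finsupp.single i 1 = 0 := by
      ext j
      by_contra hj
      have := le_multiWeight (w := w) hj
      have := hw j
      omega
    rw [h3, add_zero] at hsplit
    rw [mem_support_iff, hsplit, coeff_sub, hq1 i k h2.2, coeff_X] at hα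
    refine hα ?_
    simp [Finsupp.single_left_inj, eq_comm])
  have e : ⇑Φ = polyMap q := by
    ext x k
    rw [hΦ, PiLp.add_apply, polyMap_apply, polyMap_apply, polyFun_sub, polyFun_X]
    ring
  refine ⟨Φ, e, ⟨q, fun x k => by rw [e]; rfl⟩, fun t x => ?_, ?_⟩
  · rw [e]
    ext k
    exact polyFun_dilation (hq k) t x
  · rw [e]
    refine hasFDerivAt_polyMap_zero fun j k => ?_
    by_cases hjk : w j = w k
    · exact hq1 j k hjk
    · rw [if_neg (by rintro rfl; exact hjk rfl), ← notMem_support_iff]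
      intro hc
      have := hq k _ hc
      rw [multiWeight_single] at this
      omega

end PolynomialMaps

end CarnotMfd

namespace CarnotMfd

/-! ### Expansion of sections and brackets in an `H`-frame. -/

section Weights

theorem exists_coeff_of_mem_of_finrank_le {n : ℕ} {V : Type*} [AddCommGroup V] [Module ℝ V]
    [FiniteDimensional ℝ V] {b : Fin n → V} (hb : LinearIndependent ℝ b) {W : Submodule ℝ V}
    (s : Finset (Fin n)) (hs : ∀ k ∈ s, b k ∈ W) (hW : Module.finrank ℝ W ≤ s.card) {v : V}
    (hv : v ∈ W) : ∃ a : Fin n → ℝ, (∀ k ∉ s, a k = 0) ∧ v = ∑ k, a k • b k := by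
  have h1 : Submodule.span ℝ (Set.range fun k : s => b k) = W := by
    refine Submodule.eq_of_le_of_finrank_le (Submodule.span_le.2 ?_) ?_
    · rintro _ ⟨k, rfl⟩
      exact hs k k.2
    · rw [finrank_span_eq_card (b := fun k : s => b k) (hb.comp _ Subtype.val_injective),
        Fintype.card_coe]
      exact hW
  rw [← h1, Submodule.mem_span_range_iff_exists_fun] at hv
  obtain ⟨c, rfl⟩ := hv
  classical
  refine ⟨fun k => if h : k ∈ s then c ⟨k, h⟩ else 0, fun k hk => dif_neg hk, ?_⟩
  symm
  rw [← Finset.sum_subset (Finset.subset_univ s)]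
  · rw [← Finset.sum_coe_sort s]
    exact Finset.sum_congr rfl fun k _ => by simp
  · intro k _ hk
    simp [hk]

variable {n r : ℕ} {M : Type*} [TopologicalSpace M] [ChartedSpace (Euc n) M]

instance finiteDimensional_tangentSpace (x : M) : FiniteDimensional ℝ (TangentSpace (𝓡 n) x) :=
  inferInstanceAs (FiniteDimensional ℝ (Euc n))

theorem finrank_tangentSpace (x : M) : Module.finrank ℝ (TangentSpace (𝓡 n) x) = n :=
  finrank_euclideanSpace_fin (𝕜 := ℝ) (n := n)

variable [IsManifold (𝓡 n) ∞ M]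

theorem CarnotFiltration.finrank_eq (H : CarnotFiltration n r M) {w : ℕ} (h1 : 1 ≤ w)
    (hr : w ≤ r) (x : M) : Module.finrank ℝ (H.H w x) = H.rk w := by
  obtain ⟨U, -, hx, Y, -, hY⟩ := H.subbundle w h1 hr x
  rw [← (hY x hx).2, finrank_span_eq_card (hY x hx).1, Fintype.card_fin]

theorem CarnotFiltration.rk_le (H : CarnotFiltration n r M) {w : ℕ} (h1 : 1 ≤ w)
    (hr : w ≤ r) (x : M) : H.rk w ≤ n := by
  rw [← H.finrank_eq h1 hr x]
  exact (Submodule.finrank_le _).trans (finrank_tangentSpace x).le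

theorem CarnotFiltration.rk_step (H : CarnotFiltration n r M) (x : M) : H.rk r = n := by
  rw [← H.finrank_eq H.one_le_step le_rfl x, H.top, finrank_top, finrank_tangentSpace]

/-- The minimum exists because the top rank is `n`; a point `x` is needed to know this. -/
theorem CarnotFiltration.weight_spec (H : CarnotFiltration n r M) (x : M) (j : Fin n) :
    1 ≤ H.weight j ∧ H.weight j ≤ r ∧ (j : ℕ) + 1 ≤ H.rk (H.weight j) :=
  Nat.sInf_mem (s := {w : ℕ | 1 ≤ w ∧ w ≤ r ∧ (j : ℕ) + 1 ≤ H.rk w})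
    ⟨r, H.one_le_step, le_rfl, by rw [H.rk_step x]; exact j.2⟩

/-- The frame fields of weight at most `w` lie in `H w`, and there are at least `rk w` of them, so
they span it. -/
theorem IsHFrameOn.exists_coeff_of_mem {H : CarnotFiltration n r M} {X : Fin n → VField n M}
    {U : Set M} (hX : IsHFrameOn H X U) {x : M} (hx : x ∈ U) {w : ℕ} (h1 : 1 ≤ w) (hr : w ≤ r)
    {v : TangentSpace (𝓡 n) x} (hv : v ∈ H.H w x) :
    ∃ a : Fin n → ℝ, (∀ k, w < H.weight k → a k = 0) ∧ v = ∑ k, a k • X k x := by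
  have hcard : Module.finrank ℝ (H.H w x) ≤
      (Finset.univ.filter fun k : Fin n => H.weight k ≤ w).card := by
    rw [H.finrank_eq h1 hr]
    have h2 := Finset.card_le_card_of_injOn (s := Finset.univ (α := Fin (H.rk w)))
      (t := Finset.univ.filter fun k : Fin n => H.weight k ≤ w)
      (Fin.castLE (H.rk_le h1 hr x))
      (fun k _ => Finset.mem_coe.2 (Finset.mem_filter.2
        ⟨Finset.mem_univ _, Nat.sInf_le ⟨h1, hr, k.2⟩⟩))
      (Fin.castLE_injective _).injOn
    rwa [Finset.card_univ, Fintype.card_fin] at h2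
  obtain ⟨a, ha, hva⟩ := exists_coeff_of_mem_of_finrank_le (hX.linearIndependent x hx)
    (Finset.univ.filter fun k => H.weight k ≤ w)
    (fun k hk => H.mono _ _ (H.weight_spec x k).1 (Finset.mem_filter.1 hk).2 hr x (hX.mem k x hx))
    hcard hv
  exact ⟨a, fun k hk => ha k fun hc => (Finset.mem_filter.1 hc).2.not_gt hk, hva⟩

theorem IsHFrameOn.exists_bracket_coeff {H : CarnotFiltration n r M} {X : Fin n → VField n M}
    {U : Set M} (hU : IsOpen U) (hX : IsHFrameOn H X U) {x : M} (hx : x ∈ U) (i j : Fin n) :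
    ∃ a : Fin n → ℝ, (∀ k, H.weight i + H.weight j < H.weight k → a k = 0) ∧
      VectorField.mlieBracket (𝓡 n) (X i) (X j) x = ∑ k, a k • X k x := by
  have hi := H.weight_spec x i
  have hj := H.weight_spec x j
  by_cases hr : H.weight i + H.weight j ≤ r
  · exact hX.exists_coeff_of_mem hx (by omega) hr
      (H.bracket _ _ hi.1 hj.1 hr U hU _ _ (hX.smooth i) (hX.smooth j) (hX.mem i) (hX.mem j) x hx)
  · have hv : VectorField.mlieBracket (𝓡 n) (X i) (X j) x ∈ H.H r x := by
      rw [H.top]; exact Submodule.mem_top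
    -- Beyond the step the condition on the coefficients is empty, as all weights are at most `r`.
    obtain ⟨a, -, ha⟩ := hX.exists_coeff_of_mem hx H.one_le_step le_rfl hv
    refine ⟨a, fun k hk => ?_, ha⟩
    have := H.weight_spec x k
    omega

end Weights

/-! ### The frame and the privileged condition in local coordinates. -/

section Coordinates

variable {n : ℕ} {M : Type*} [TopologicalSpace M] [ChartedSpace (Euc n) M]

/-- Smooth coordinates near `a`, centered at `a`. -/
structure IsSmoothCoord (a : M) (θ : OpenPartialHomeomorph M (Euc n)) : Prop where
  contMDiffOn : ContMDiffOn (𝓡 n) 𝓘(ℝ, Euc n) ∞ θ θ.source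
  contMDiffOn_symm : ContMDiffOn 𝓘(ℝ, Euc n) (𝓡 n) ∞ θ.symm θ.target
  mem_source : a ∈ θ.source
  map_zero : θ a = 0

theorem IsCenteredChart.isSmoothCoord [IsManifold (𝓡 n) ∞ M] {a : M}
    {κ : OpenPartialHomeomorph M (Euc n)} (hκ : IsCenteredChart a κ) : IsSmoothCoord a κ :=
  ⟨contMDiffOn_of_mem_maximalAtlas hκ.mem_maximalAtlas,
    contMDiffOn_symm_of_mem_maximalAtlas hκ.mem_maximalAtlas, hκ.mem_source, hκ.map_zero⟩

theorem IsSmoothCoord.transDiffeomorph {a : M} {θ : OpenPartialHomeomorph M (Euc n)}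
    (hθ : IsSmoothCoord a θ) (Φ : Diffeomorph 𝓘(ℝ, Euc n) 𝓘(ℝ, Euc n) (Euc n) (Euc n) ∞)
    (hΦ : Φ 0 = 0) : IsSmoothCoord a (θ.transHomeomorph Φ.toHomeomorph) where
  contMDiffOn := Φ.contMDiff.comp_contMDiffOn hθ.contMDiffOn
  contMDiffOn_symm := hθ.contMDiffOn_symm.comp Φ.symm.contMDiff.contMDiffOn fun _ h => h
  mem_source := hθ.mem_source
  map_zero := by
    change Φ (θ a) = 0
    rw [hθ.map_zero, hΦ]

/-- The vector fields `X` in the coordinates `θ`. -/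
noncomputable def pushFrame (θ : OpenPartialHomeomorph M (Euc n)) (X : Fin n → VField n M)
    (j : Fin n) : Euc n → Euc n :=
  VectorField.mpullback 𝓘(ℝ, Euc n) (𝓡 n) θ.symm (X j)

variable {a : M} {θ : OpenPartialHomeomorph M (Euc n)}

namespace IsSmoothCoord

theorem zero_mem_target (hθ : IsSmoothCoord a θ) : (0 : Euc n) ∈ θ.target := by
  rw [← hθ.map_zero]; exact θ.map_source hθ.mem_source

theorem symm_zero (hθ : IsSmoothCoord a θ) : θ.symm 0 = a := by
  rw [← hθ.map_zero]; exact θ.left_inv hθ.mem_source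

theorem mdifferentiable (hθ : IsSmoothCoord a θ) : θ.MDifferentiable (𝓡 n) 𝓘(ℝ, Euc n) :=
  ⟨hθ.contMDiffOn.mdifferentiableOn (by simp), hθ.contMDiffOn_symm.mdifferentiableOn (by simp)⟩

theorem isInvertible_mfderiv_symm (hθ : IsSmoothCoord a θ) {y : Euc n} (hy : y ∈ θ.target) :
    (mfderiv 𝓘(ℝ, Euc n) (𝓡 n) θ.symm y).IsInvertible :=
  ⟨hθ.mdifferentiable.symm.mfderiv hy, rfl⟩

theorem pushFrame_eq (hθ : IsSmoothCoord a θ) (X : Fin n → VField n M) (j : Fin n) {p : M}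
    (hp : p ∈ θ.source) :
    pushFrame θ X j (θ p) = mfderiv (𝓡 n) 𝓘(ℝ, Euc n) θ p (X j p) := by
  -- The point `q` stands for `θ.symm (θ p)`, whose tangent space is a type depending on the point;
  -- generalizing it permits the substitution.
  have h1 : ∀ q, q = p → mfderiv 𝓘(ℝ, Euc n) (𝓡 n) θ.symm (θ p)
      (mfderiv (𝓡 n) 𝓘(ℝ, Euc n) θ p (X j p)) = X j q := by
    rintro _ rfl
    exact congrArg (fun L => L (X j _)) (hθ.mdifferentiable.symm_comp_deriv hp)
  refine ((hθ.isInvertible_mfderiv_symm (θ.map_source hp)).inverse_apply_eq).2 ?_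
  exact (h1 _ (θ.left_inv hp)).symm

theorem lieDeriv_eventuallyEq (hθ : IsSmoothCoord a θ) (X : Fin n → VField n M) (j : Fin n)
    {g : Euc n → ℝ} (hg : ContDiffAt ℝ ∞ g 0) {h : M → ℝ} (hgh : h =ᶠ[𝓝 a] g ∘ θ) :
    lieDeriv (X j) h =ᶠ[𝓝 a] vDeriv (pushFrame θ X j) g ∘ θ := by
  have hc : Filter.Tendsto θ (𝓝 a) (𝓝 0) := by
    have := θ.continuousAt hθ.mem_source
    rwa [ContinuousAt, hθ.map_zero] at this
  filter_upwards [hgh.eventuallyEq_nhds, θ.open_source.mem_nhds hθ.mem_source,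
    hc.eventually (eventually_differentiableAt hg)] with p h1 h2 h3
  rw [lieDeriv, h1.mfderiv_eq, Function.comp_apply, vDeriv, hθ.pushFrame_eq X j h2,
    ← mfderiv_eq_fderiv]
  exact mfderiv_comp_apply p h3.mdifferentiableAt (hθ.mdifferentiable.mdifferentiableAt h2) (X j p)

theorem iterDeriv_eventuallyEq (hθ : IsSmoothCoord a θ) {X : Fin n → VField n M}
    (hX : ∀ j, ContDiffAt ℝ ∞ (pushFrame θ X j) 0) {g : Euc n → ℝ} (hg : ContDiffAt ℝ ∞ g 0)
    {h : M → ℝ} (hgh : h =ᶠ[𝓝 a] g ∘ θ) (I : List (Fin n)) :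
    iterDeriv X I h =ᶠ[𝓝 a] iterVDeriv (pushFrame θ X) I g ∘ θ := by
  induction I with
  | nil => exact hgh
  | cons i I ih => exact hθ.lieDeriv_eventuallyEq X i (contDiffAt_iterVDeriv hX hg I) ih

theorem contDiffAt_pushFrame [IsManifold (𝓡 n) ∞ M] (hθ : IsSmoothCoord a θ)
    {X : Fin n → VField n M} {U : Set M} (hU : IsOpen U) (hX : ∀ j, SmoothVFieldOn (X j) U)
    (haU : a ∈ U) (j : Fin n) : ContDiffAt ℝ ∞ (pushFrame θ X j) 0 := by
  refine contMDiffAt_vectorSpace_iff_contDiffAt.1 ?_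
  refine ContMDiffAt.mpullback_vectorField_preimage (n := ∞) (m := ∞) ?_
    (hθ.contMDiffOn_symm.contMDiffAt (θ.open_target.mem_nhds hθ.zero_mem_target))
    (hθ.isInvertible_mfderiv_symm hθ.zero_mem_target) (by simp)
  rw [hθ.symm_zero]
  exact (hX j).contMDiffAt (hU.mem_nhds haU)

theorem lieBracket_pushFrame [IsManifold (𝓡 n) ∞ M] (hθ : IsSmoothCoord a θ)
    {X : Fin n → VField n M} {U : Set M} (hU : IsOpen U) (hX : ∀ j, SmoothVFieldOn (X j) U)
    (i j : Fin n) {y : Euc n} (hy : y ∈ θ.target) (hyU : θ.symm y ∈ U) :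
    VectorField.lieBracket ℝ (pushFrame θ X i) (pushFrame θ X j) y =
      VectorField.mpullback 𝓘(ℝ, Euc n) (𝓡 n) θ.symm
        (VectorField.mlieBracket (𝓡 n) (X i) (X j)) y := by
  have : IsManifold (𝓡 n) (minSmoothness ℝ 2) M := by
    rw [minSmoothness_of_isRCLikeNormedField]; infer_instance
  have hd : ∀ j, MDifferentiableAt (𝓡 n) (𝓡 n).tangent
      (fun x => (⟨x, X j x⟩ : TangentBundle (𝓡 n) M)) (θ.symm y) := fun j =>
    ((hX j).contMDiffAt (hU.mem_nhds hyU)).mdifferentiableAt (by simp)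
  rw [VectorField.mpullback_mlieBracket (n := ∞) (hd i) (hd j)
    (hθ.contMDiffOn_symm.contMDiffAt (θ.open_target.mem_nhds hy))
    (by rw [minSmoothness_of_isRCLikeNormedField]; exact two_le_infty)]
  rw [← VectorField.mlieBracketWithin_univ, VectorField.mlieBracketWithin_eq_lieBracketWithin,
    ← VectorField.lieBracketWithin_univ]
  rfl

variable {r : ℕ} [IsManifold (𝓡 n) ∞ M]

theorem isAdaptedFrame_pushFrame (hθ : IsSmoothCoord a θ) {H : CarnotFiltration n r M}
    {X : Fin n → VField n M} {U : Set M} (hU : IsOpen U) (haU : a ∈ U) (hX : IsHFrameOn H X U)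
    (hθX : LinearlyAdapted X a θ) : IsAdaptedFrame H.weight (pushFrame θ X) := by
  have hsm := hθ.contDiffAt_pushFrame hU hX.smooth haU
  have h0 : ∀ j, pushFrame θ X j 0 = EuclideanSpace.single j (1 : ℝ) := by
    intro j
    rw [← hθX.2 j, ← hθ.pushFrame_eq X j hθ.mem_source, hθ.map_zero]
  refine ⟨hsm, h0, fun i j => ?_⟩
  obtain ⟨c, hc, hcY⟩ := exists_frame_coeff hsm h0
  have hlie : ContDiffAt ℝ ∞
      (VectorField.lieBracket ℝ (pushFrame θ X i) (pushFrame θ X j)) 0 :=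
    (hsm i).lieBracket_vectorField (hsm j) (by simp)
  have hnear : ∀ᶠ y in 𝓝 (0 : Euc n), y ∈ θ.target ∧ θ.symm y ∈ U := by
    refine (θ.open_target.eventually_mem hθ.zero_mem_target).and ?_
    refine (θ.continuousAt_symm hθ.zero_mem_target).eventually ?_
    rw [hθ.symm_zero]
    exact hU.mem_nhds haU
  -- The coefficients of the bracket in the moving frame are smooth. By uniqueness they agree
  -- pointwise with those given by the filtration, whence the vanishing for large w_k.
  refine ⟨fun k y => c y (VectorField.lieBracket ℝ (pushFrame θ X i) (pushFrame θ X j) y) k,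
    fun k => (contDiffAt_coord k _).comp (0 : Euc n) (hc.clm_apply hlie), fun k hk => ?_, ?_⟩
  · filter_upwards [hnear, hcY] with y ⟨hy, hyU⟩ hcy
    obtain ⟨b, hb, hbX⟩ := hX.exists_bracket_coeff hU hyU i j
    have e : VectorField.lieBracket ℝ (pushFrame θ X i) (pushFrame θ X j) y =
        ∑ k, (WithLp.toLp 2 b : Euc n) k • pushFrame θ X k y := by
      rw [hθ.lieBracket_pushFrame hU hX.smooth i j hy hyU, VectorField.mpullback_apply, hbX,
        map_sum]
      simp only [map_smul]
      rfl
    rw [e, hcy.2]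
    exact hb k hk
  · filter_upwards [hcY] with y hcy
    exact (hcy.1 _).symm

/-- A criterion for coordinates to be privileged, in terms of their expression `F` in linearly
adapted coordinates. -/
theorem privileged_iff (hθ : IsSmoothCoord a θ) {H : CarnotFiltration n r M}
    {X : Fin n → VField n M} {U : Set M} (hU : IsOpen U) (haU : a ∈ U) (hX : IsHFrameOn H X U)
    (hθX : LinearlyAdapted X a θ) {F : Euc n → Euc n} (hF : ContDiffAt ℝ ∞ F 0)
    {h : M → Euc n} (hFh : h =ᶠ[𝓝 a] F ∘ θ) :
    Privileged X H.weight a h ↔ F 0 = 0 ∧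
      HasFDerivAt F (ContinuousLinearMap.id ℝ (Euc n)) 0 ∧
      ∀ k, VanishesToOrder (pushFrame θ X) H.weight (H.weight k) fun y => F y k := by
  have hY := hθ.isAdaptedFrame_pushFrame hU haU hX hθX
  have hFd : DifferentiableAt ℝ F 0 := hF.differentiableAt (by simp)
  have hder : ∀ j, mfderiv (𝓡 n) 𝓘(ℝ, Euc n) h a (X j a) =
      fderiv ℝ F 0 (EuclideanSpace.single j (1 : ℝ)) := by
    intro j
    rw [hFh.mfderiv_eq, ← hθX.2 j, ← mfderiv_eq_fderiv]
    exact mfderiv_comp_apply_of_eq (g := F) (f := θ) a hFd.mdifferentiableAt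
      (hθ.mdifferentiable.mdifferentiableAt hθ.mem_source) hθ.map_zero (X j a)
  have hlin : LinearlyAdapted X a h ↔
      F 0 = 0 ∧ HasFDerivAt F (ContinuousLinearMap.id ℝ (Euc n)) 0 := by
    refine and_congr ?_ ⟨fun h1 => ?_, fun h1 j => ?_⟩
    · rw [hFh.eq_of_nhds, Function.comp_apply, hθ.map_zero]
    · refine hFd.hasFDerivAt.congr_fderiv ?_
      ext1 v
      rw [← sum_smul_single v, map_sum, map_sum]
      refine Finset.sum_congr rfl fun j _ => ?_
      rw [map_smul, map_smul, ← hder, h1 j]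
      rfl
    · rw [hder, h1.fderiv]
      rfl
  have hiter : ∀ k I, iterDeriv X I (fun p => h p k) a =
      iterVDeriv (pushFrame θ X) I (fun y => F y k) 0 := by
    intro k I
    have hFk : ContDiffAt ℝ ∞ (fun y => F y k) 0 := (contDiffAt_coord k _).comp (0 : Euc n) hF
    have := (hθ.iterDeriv_eventuallyEq hY.smooth hFk
      (h := fun p => h p k) (hFh.fun_comp fun v => v k) I).eq_of_nhds
    rwa [Function.comp_apply, hθ.map_zero] at this
  rw [Privileged, hlin, and_assoc]
  refine and_congr_right fun _ => and_congr_right fun hF1 => forall_congr' fun k => ?_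
  simp only [HasOrder, hiter]
  -- The order is exactly w_k for free: the one-letter word `[k]` has weight w_k and gives the value
  -- 1 on the `k`-th component.
  refine ⟨fun h1 => h1.1, fun h1 => ⟨h1, [k], by simp [listWeight], ?_⟩⟩
  have hd : HasFDerivAt (fun y => F y k)
      ((EuclideanSpace.proj k : Euc n →L[ℝ] ℝ).comp (ContinuousLinearMap.id ℝ (Euc n))) 0 :=
    (EuclideanSpace.proj k : Euc n →L[ℝ] ℝ).hasFDerivAt.comp (0 : Euc n) hF1
  change fderiv ℝ (fun y => F y k) 0 (pushFrame θ X k 0) ≠ 0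
  rw [hd.fderiv, hY.eq_single]
  simp

end IsSmoothCoord

end Coordinates

end CarnotMfd

namespace CarnotMfd

open Asymptotics

/-! ### The triangular change of coordinates, and bounds for homogeneous functions. -/

section Triangular

variable {n : ℕ} {w : Fin n → ℕ} {Y : Fin n → Euc n → Euc n}

/-- Linearly adapted coordinates become privileged after a unique triangular polynomial change. -/
theorem IsAdaptedFrame.exists_triangular (hY : IsAdaptedFrame w Y) (hw : ∀ i, 1 ≤ w i) :
    ∃ f, IsTriangularPoly w f ∧ ∀ k, VanishesToOrder Y w (w k) fun y => f y k := by
  have h0 : (∞ : WithTop ℕ∞) ≠ 0 := by simp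
  choose p hp h using fun k => hY.exists_polyFun hw (contDiffAt_coord k 0) (w k)
  -- The constant term is tested by the empty word. A linear term in x_j with w_j < w_k is tested by
  -- `[j]`, and X_j x_k = 0 at the origin because j ≠ k.
  have hlow : ∀ k, ∀ α ∈ (p k).support, 2 ≤ multiLength α := by
    intro k α hα
    by_contra! hlt
    rw [MvPolynomial.mem_support_iff] at hα
    have hαw := hp k α (MvPolynomial.mem_support_iff.2 hα)
    have hc0 : (p k).coeff 0 = 0 := by
      have := h k [] (hw k)
      change (0 : Euc n) k - polyFun (p k) 0 = 0 at this
      rw [polyFun_zero_right] at this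
      simpa using this
    by_cases hα0 : α = 0
    · exact hα (hα0 ▸ hc0)
    · obtain ⟨j, hj⟩ : ∃ j, α j ≠ 0 := by
        by_contra! hc; exact hα0 (Finsupp.ext hc)
      have hsplit : α = Finsupp.single j 1 + (α - Finsupp.single j 1) := by
        rw [add_tsub_cancel_of_le]
        rwa [Finsupp.single_le_iff, Nat.one_le_iff_ne_zero]
      have h3 : α - Finsupp.single j 1 = 0 := by
        rw [hsplit, ← multiWeight_one, multiWeight_add, multiWeight_single] at hlt
        ext i
        by_contra hi
        have := le_multiWeight (w := fun _ : Fin n => 1) hi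
        omega
      rw [h3, add_zero] at hsplit
      subst hsplit
      rw [multiWeight_single, mul_one] at hαw
      have h1 : vDeriv (Y j) (fun y => y k - polyFun (p k) y) 0 = 0 :=
        h k [j] (by simpa [listWeight] using hαw)
      rw [vDeriv, fderiv_fun_sub ((contDiffAt_coord k 0).differentiableAt h0)
        ((contDiffAt_polyFun (p k) 0).differentiableAt h0), _root_.sub_apply,
        fderiv_coord, hY.eq_single, fderiv_polyFun_zero] at h1
      have hjk : k ≠ j := by rintro rfl; exact lt_irrefl _ hαw
      rw [PiLp.single_apply, if_neg hjk, zero_sub, neg_eq_zero] at h1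
      exact hα h1
  refine ⟨polyMap fun k => MvPolynomial.X k - p k, ⟨fun k => -p k, fun k α hα => ?_,
    fun x k => ?_⟩, fun k => ?_⟩
  · rw [MvPolynomial.support_neg] at hα
    exact ⟨hp k α hα, hlow k α hα⟩
  · rw [polyMap_apply, polyFun_sub, polyFun_X, map_neg, sub_eq_add_neg]
    rfl
  · simpa only [polyMap_apply, polyFun_sub, polyFun_X] using h k

theorem IsAdaptedFrame.triangular_unique (hY : IsAdaptedFrame w Y) {f g : Euc n → Euc n}
    (hf : IsTriangularPoly w f) (hg : IsTriangularPoly w g)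
    (hfY : ∀ k, VanishesToOrder Y w (w k) fun y => f y k)
    (hgY : ∀ k, VanishesToOrder Y w (w k) fun y => g y k) : f = g := by
  obtain ⟨P, hP, hPf⟩ := hf
  obtain ⟨Q, hQ, hQg⟩ := hg
  have hs : ∀ (F : Euc n → Euc n) (R : Fin n → MvPolynomial (Fin n) ℝ),
      (∀ x k, F x k = x k + MvPolynomial.eval (fun i => x i) (R k)) → ∀ k,
      ContDiffAt ℝ ∞ (fun y => F y k) 0 := by
    intro F R h k
    simp only [h]
    exact (contDiffAt_coord k 0).add (contDiffAt_polyFun (R k) 0)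
  have hPQ : ∀ k, P k - Q k = 0 := by
    intro k
    refine hY.eq_zero_of_vanishesToOrder (N := w k) (fun α hα => ?_) ?_
    · rcases Finset.mem_union.1 (MvPolynomial.support_sub _ _ _ hα) with h | h
      · exact (hP k α h).1
      · exact (hQ k α h).1
    · convert (hfY k).sub hY.smooth (hs f P hPf k) (hs g Q hQg k) (hgY k) using 2 with x
      rw [hPf, hQg, polyFun_sub, polyFun, polyFun]
      ring
  ext x k
  rw [hPf, hQg, sub_eq_zero.1 (hPQ k)]

/-- The level set `N = 1` is bounded, so `g` is bounded on it, and homogeneity does the rest. Only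
continuity of φ̂ is needed for the converse direction. -/
theorem IsPseudoNorm.isBigO_of_homogeneous {N : Euc n → ℝ} (hN : IsPseudoNorm w N)
    (hw : ∀ i, 1 ≤ w i) {g : Euc n → ℝ} (hg : Continuous g) {m : ℕ} (hm : 1 ≤ m)
    (hgm : ∀ t x, g (CarnotMfd.dilation w t x) = t ^ m * g x) :
    g =O[𝓝 0] fun x => N x ^ m := by
  choose C hC using hN.exists_abs_coord_le hw
  obtain ⟨B, hB⟩ := (isCompact_closedBall (0 : Euc n) (∑ k, C k)).exists_bound_of_continuousOn
    hg.continuousOn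
  refine IsBigO.of_bound B (Filter.Eventually.of_forall fun x => ?_)
  rw [norm_pow, Real.norm_of_nonneg (hN.nonneg x)]
  by_cases hx : x = 0
  · have h0 := hgm 0 0
    rw [dilation_zero hw, zero_pow (by omega), zero_mul] at h0
    rw [hx, h0, hN.zero hw, zero_pow (by omega)]
    simp
  · have hpos := hN.pos x hx
    set y := CarnotMfd.dilation w (N x)⁻¹ x with hy
    have hyN : N y = 1 := by
      rw [hy, hN.dilation, abs_of_pos (inv_pos.2 hpos), inv_mul_cancel₀ hpos.ne']
    have hyb : ‖y‖ ≤ ∑ k, C k := by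
      rw [← sum_smul_single y]
      refine (norm_sum_le _ _).trans (Finset.sum_le_sum fun k _ => ?_)
      rw [norm_smul, PiLp.norm_single, norm_one, mul_one, Real.norm_eq_abs]
      simpa [hyN] using hC k y
    have hgx : g x = N x ^ m * g y := by
      rw [← hgm, hy, dilation_dilation, mul_inv_cancel₀ hpos.ne', dilation_one]
    rw [hgx, norm_mul, norm_pow, Real.norm_of_nonneg hpos.le, mul_comm]
    exact mul_le_mul_of_nonneg_right (hB y (mem_closedBall_zero_iff.2 hyb))
      (pow_nonneg hpos.le m)

end Triangular

/-! ### Existence of ψ and the characterization of privileged charts. -/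

section Manifold

variable {n r : ℕ} {M : Type*} [TopologicalSpace M] [ChartedSpace (Euc n) M] {a : M}

theorem linearlyAdapted_affine_iff {X : Fin n → VField n M}
    {κ : OpenPartialHomeomorph M (Euc n)} (hκ : IsSmoothCoord a κ) (T : Euc n ≃ᵃ[ℝ] Euc n) :
    LinearlyAdapted X a (fun p => T (κ p)) ↔ T 0 = 0 ∧
      ∀ j, T.linear (mfderiv (𝓡 n) 𝓘(ℝ, Euc n) κ a (X j a)) =
        EuclideanSpace.single j (1 : ℝ) := by
  have hT : ∀ x, T x = T.linear.toContinuousLinearEquiv x + T 0 := fun x =>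
    (congrFun (AffineMap.decomp (T : Euc n →ᵃ[ℝ] Euc n)) x)
  have hd : HasFDerivAt T (T.linear.toContinuousLinearEquiv : Euc n →L[ℝ] Euc n) (κ a) := by
    have := (T.linear.toContinuousLinearEquiv : Euc n →L[ℝ] Euc n).hasFDerivAt
      (x := κ a) |>.add_const (T 0)
    exact this.congr_of_eventuallyEq (Filter.Eventually.of_forall hT)
  have h0 : T (κ a) = 0 ↔ T 0 = 0 := by rw [hκ.map_zero]
  refine and_congr h0 (forall_congr' fun j => ?_)
  have e : mfderiv (𝓡 n) 𝓘(ℝ, Euc n) (fun p => T (κ p)) a (X j a) =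
      fderiv ℝ T (κ a) (mfderiv (𝓡 n) 𝓘(ℝ, Euc n) κ a (X j a)) := by
    rw [← mfderiv_eq_fderiv]
    exact mfderiv_comp_apply (g := T) (f := κ) a hd.differentiableAt.mdifferentiableAt
      (hκ.mdifferentiable.mdifferentiableAt hκ.mem_source) (X j a)
  rw [e, hd.fderiv]
  rfl

variable [IsManifold (𝓡 n) ∞ M] {H : CarnotFiltration n r M} {X : Fin n → VField n M} {U : Set M}

/-- The images of the X_j(a) under the differential of κ form a basis, which fixes the linear part;
centering at 0 kills the translation. -/
theorem exists_linearlyAdapted (haU : a ∈ U) (hX : IsHFrameOn H X U)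
    {κ : OpenPartialHomeomorph M (Euc n)} (hκ : IsSmoothCoord a κ) :
    ∃ L : Euc n ≃L[ℝ] Euc n, LinearlyAdapted X a (fun p => L (κ p)) ∧
      ∀ T : Euc n ≃ᵃ[ℝ] Euc n, LinearlyAdapted X a (fun p => T (κ p)) → ∀ x, T x = L x := by
  let b : Module.Basis (Fin n) ℝ (TangentSpace (𝓡 n) a) :=
    Module.Basis.mk (hX.linearIndependent a haU) (hX.span_eq_top a haU).ge
  let e : TangentSpace (𝓡 n) a ≃ₗ[ℝ] Euc n :=
    (hκ.mdifferentiable.mfderiv hκ.mem_source).toLinearEquiv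
  let c : Module.Basis (Fin n) ℝ (Euc n) := b.map e
  have hc : ∀ j, c j = mfderiv (𝓡 n) 𝓘(ℝ, Euc n) κ a (X j a) := by
    intro j
    simp only [c, Module.Basis.map_apply, b, Module.Basis.mk_apply]
    rfl
  let L : Euc n ≃ₗ[ℝ] Euc n :=
    c.equiv (EuclideanSpace.basisFun (Fin n) ℝ).toBasis (Equiv.refl _)
  have hL : ∀ j, L (c j) = EuclideanSpace.single j (1 : ℝ) := by
    intro j
    simp [L]
  refine ⟨L.toContinuousLinearEquiv, ?_, fun T hT x => ?_⟩
  · refine (linearlyAdapted_affine_iff hκ L.toAffineEquiv).2 ⟨map_zero L, fun j => ?_⟩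
    rw [← hc, ← hL]
    rfl
  · rw [linearlyAdapted_affine_iff hκ] at hT
    have h1 : (T.linear : Euc n →ₗ[ℝ] Euc n) = L := by
      refine c.ext fun j => ?_
      have := hT.2 j
      rw [← hc, ← hL] at this
      exact this
    have h2 : T x = T.linear x + T 0 :=
      congrFun (AffineMap.decomp (T : Euc n →ᵃ[ℝ] Euc n)) x
    rw [h2, hT.1, add_zero]
    exact congrArg (fun F : Euc n →ₗ[ℝ] Euc n => F x) h1

theorem IsTriangularPoly.contDiffAt {w : Fin n → ℕ} {f : Euc n → Euc n}
    (hf : IsTriangularPoly w f) (x : Euc n) : ContDiffAt ℝ ∞ f x := by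
  obtain ⟨Φ, rfl⟩ := hf.exists_diffeomorph
  exact Φ.contMDiff.contDiff.contDiffAt

theorem exists_isPsiMap (hU : IsOpen U) (haU : a ∈ U) (hX : IsHFrameOn H X U)
    {κ : OpenPartialHomeomorph M (Euc n)} (hκ : IsSmoothCoord a κ) :
    ∃ ψ, IsPsiMap X H.weight a κ ψ ∧ ∀ ψ₂, IsPsiMap X H.weight a κ ψ₂ → ψ₂ = ψ := by
  obtain ⟨L, hL, hLu⟩ := exists_linearlyAdapted haU hX hκ
  have hθ := hκ.transDiffeomorph L.toDiffeomorph (map_zero L)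
  set θ := κ.transHomeomorph L.toDiffeomorph.toHomeomorph
  have hY := hθ.isAdaptedFrame_pushFrame hU haU hX hL
  have hpriv : ∀ f, IsTriangularPoly H.weight f →
      (Privileged X H.weight a (fun p => f (L (κ p))) ↔
        ∀ k, VanishesToOrder (pushFrame θ X) H.weight (H.weight k) fun y => f y k) := by
    intro f hf
    refine (hθ.privileged_iff hU haU hX hL (hf.contDiffAt 0)
      (h := fun p => f (L (κ p))) Filter.EventuallyEq.rfl).trans ?_
    exact ⟨fun h => h.2.2, fun h => ⟨hf.hasFDerivAt_zero.1, hf.hasFDerivAt_zero.2, h⟩⟩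
  obtain ⟨f, hf, hfY⟩ := hY.exists_triangular fun i => (H.weight_spec a i).1
  refine ⟨fun x => f (L x), ⟨L.toLinearEquiv.toAffineEquiv, f, hL, hf, (hpriv f hf).2 hfY, rfl⟩, ?_⟩
  rintro _ ⟨T, g, hT, hg, hgp, rfl⟩
  have hTL := hLu T hT
  simp only [hTL] at hgp ⊢
  rw [hY.triangular_unique hg hf ((hpriv g hg).1 hgp) hfY]

theorem isPsiMap_psiMap (hU : IsOpen U) (haU : a ∈ U) (hX : IsHFrameOn H X U)
    {κ : OpenPartialHomeomorph M (Euc n)} (hκ : IsSmoothCoord a κ) :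
    IsPsiMap X H.weight a κ (psiMap X H.weight a κ) ∧
      ∀ ψ, IsPsiMap X H.weight a κ ψ → ψ = psiMap X H.weight a κ := by
  obtain ⟨ψ, hψ, hu⟩ := exists_isPsiMap hU haU hX hκ
  have h1 : IsPsiMap X H.weight a κ (psiMap X H.weight a κ) := Classical.epsilon_spec ⟨ψ, hψ⟩
  exact ⟨h1, fun ψ₂ h₂ => (hu ψ₂ h₂).trans (hu _ h1).symm⟩

theorem IsPsiMap.exists_isSmoothCoord (haU : a ∈ U) (hX : IsHFrameOn H X U)
    {κ : OpenPartialHomeomorph M (Euc n)} (hκ : IsSmoothCoord a κ) {ψ : Euc n → Euc n}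
    (hψ : IsPsiMap X H.weight a κ ψ) :
    ∃ θ : OpenPartialHomeomorph M (Euc n), IsSmoothCoord a θ ∧ Privileged X H.weight a θ ∧
      ∀ p, θ p = ψ (κ p) := by
  obtain ⟨T, f, hT, hf, hp, rfl⟩ := hψ
  obtain ⟨L, hL, hLu⟩ := exists_linearlyAdapted haU hX hκ
  simp only [hLu T hT] at hp ⊢
  obtain ⟨Φ, rfl⟩ := hf.exists_diffeomorph
  exact ⟨_, (hκ.transDiffeomorph L.toDiffeomorph (map_zero L)).transDiffeomorph Φ
    hf.hasFDerivAt_zero.1, hp, fun p => rfl⟩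

/-- Privileged coordinates are exactly the admissible changes of given privileged coordinates. -/
theorem privileged_iff_exists_admissible (hU : IsOpen U) (haU : a ∈ U) (hX : IsHFrameOn H X U)
    {N : Euc n → ℝ} (hN : IsPseudoNorm H.weight N) {θ : OpenPartialHomeomorph M (Euc n)}
    (hθ : IsSmoothCoord a θ) (hθp : Privileged X H.weight a θ)
    {χ : OpenPartialHomeomorph M (Euc n)} (hχ : χ ∈ IsManifold.maximalAtlas (𝓡 n) ∞ M)
    (haχ : a ∈ χ.source) :
    Privileged X H.weight a χ ↔
      ∃ φ : OpenPartialHomeomorph (Euc n) (Euc n), IsAdmissibleChange H.weight N φ ∧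
        ∀ᶠ p in 𝓝 a, χ p = φ (θ p) := by
  have hw : ∀ i, 1 ≤ H.weight i := fun i => (H.weight_spec a i).1
  have hY := hθ.isAdaptedFrame_pushFrame hU haU hX hθp.1
  have hx := ((hθ.privileged_iff hU haU hX hθp.1 contDiffAt_id
    (Filter.EventuallyEq.rfl (f := θ))).1 hθp).2.2
  simp only [id] at hx
  constructor
  · intro hp
    have hχs := contMDiffOn_of_mem_maximalAtlas hχ
    have hχs' := contMDiffOn_symm_of_mem_maximalAtlas hχ
    -- The transition map is the only candidate near 0; its admissibility is read off from the
    -- orders of its components.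
    set φ := θ.symm.trans χ with hφ
    have h0 : (0 : Euc n) ∈ φ.source := by
      rw [hφ, OpenPartialHomeomorph.trans_source]
      refine ⟨hθ.zero_mem_target, ?_⟩
      rwa [Set.mem_preimage, hθ.symm_zero]
    have hsm : ContDiffOn ℝ ∞ φ φ.source := by
      rw [← contMDiffOn_iff_contDiffOn]
      refine hχs.comp (hθ.contMDiffOn_symm.mono ?_) ?_
      · exact fun y hy => hy.1
      · exact fun y hy => hy.2
    have hsm' : ContDiffOn ℝ ∞ φ.symm φ.target := by
      rw [← contMDiffOn_iff_contDiffOn]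
      refine hθ.contMDiffOn.comp (hχs'.mono ?_) ?_
      · exact fun y hy => hy.1
      · exact fun y hy => hy.2
    have hφ0 : ContDiffAt ℝ ∞ φ 0 := hsm.contDiffAt (φ.open_source.mem_nhds h0)
    have heq : χ =ᶠ[𝓝 a] φ ∘ θ := by
      filter_upwards [θ.open_source.mem_nhds hθ.mem_source] with p hpθ
      change χ p = χ (θ.symm (θ p))
      rw [θ.left_inv hpθ]
    obtain ⟨-, hφd, hφv⟩ := (hθ.privileged_iff hU haU hX hθp.1 hφ0 heq).1 hp
    have hφk : ∀ k, ContDiffAt ℝ ∞ (fun y => φ y k) 0 := fun k =>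
      (contDiffAt_coord k _).comp (0 : Euc n) hφ0
    choose q hq hqO hq1 using fun k => hY.exists_homogeneous_approx hw hN hx (hφk k) (hφv k)
    obtain ⟨Φ, hΦq, hΦpoly, hΦhom, hΦd⟩ := exists_diffeomorph_homogeneous hw hq (by
      intro j k hjk
      have hd : HasFDerivAt (fun y => φ y k)
          ((EuclideanSpace.proj k : Euc n →L[ℝ] ℝ).comp (ContinuousLinearMap.id ℝ (Euc n))) 0 :=
        (EuclideanSpace.proj k : Euc n →L[ℝ] ℝ).hasFDerivAt.comp (0 : Euc n) hφd
      rw [hq1 k j hjk, vDeriv, hd.fderiv, hY.eq_single]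
      simp [eq_comm])
    refine ⟨φ, ⟨h0, hsm, hsm', hφd, Φ, hΦpoly, hΦhom, hΦd, fun k => ?_⟩, heq⟩
    rw [hΦq]
    exact hqO k
  · rintro ⟨φ, hφ, heq⟩
    obtain ⟨Φ, -, hΦhom, -, hΦO⟩ := hφ.expansion
    have hφ0 : ContDiffAt ℝ ∞ φ 0 :=
      hφ.contDiffOn.contDiffAt (φ.open_source.mem_nhds hφ.zero_mem)
    -- This bound gives the order of each component and also φ(0) = 0, since `N 0 = 0` and the
    -- weights are positive.
    have hO : ∀ k, (fun y => φ y k) =O[𝓝 0] fun x => N x ^ H.weight k := by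
      intro k
      have h1 : (fun y => Φ y k) =O[𝓝 0] fun x => N x ^ H.weight k := by
        refine hN.isBigO_of_homogeneous hw
          ((EuclideanSpace.proj k : Euc n →L[ℝ] ℝ).continuous.comp Φ.continuous) (hw k) ?_
        intro t x
        exact congrArg (fun v : Euc n => v k) (hΦhom t x)
      have h2 := ((hΦO k).trans (hN.isBigO_pow (Nat.le_succ _))).add h1
      refine h2.congr_left fun x => ?_
      simp
    refine (hθ.privileged_iff hU haU hX hθp.1 hφ0 heq).2 ⟨?_, hφ.hasFDerivAt, fun k =>
      hY.vanishesToOrder_of_isBigO hw hN hx ((contDiffAt_coord k _).comp (0 : Euc n) hφ0) (hO k)⟩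
    ext k
    have h1 := (hO k).eq_zero_imp.self_of_nhds
    exact h1 (by rw [hN.zero hw, zero_pow (by have := hw k; omega)])

theorem isTriangularPoly_id (w : Fin n → ℕ) : IsTriangularPoly w (id : Euc n → Euc n) :=
  ⟨fun _ => 0, by simp, by simp⟩

theorem isAdmissibleChange_refl (w : Fin n → ℕ) (N : Euc n → ℝ) :
    IsAdmissibleChange w N (OpenPartialHomeomorph.refl (Euc n)) where
  zero_mem := Set.mem_univ _
  contDiffOn := contDiffOn_id
  contDiffOn_symm := contDiffOn_id
  hasFDerivAt := hasFDerivAt_id _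
  expansion := ⟨Diffeomorph.refl _ _ _, ⟨fun k => MvPolynomial.X k, by simp⟩, fun _ _ => rfl,
    hasFDerivAt_id _, fun k => by simpa using isBigO_zero _ _⟩

end Manifold

end CarnotMfd

theorem corollary5p6 {n r : ℕ} {M : Type*} [TopologicalSpace M]
    [ChartedSpace (CarnotMfd.Euc n) M] [IsManifold (𝓡 n) ∞ M]
    (H : CarnotMfd.CarnotFiltration n r M) (a : M)
    (U : Set M) (hU : IsOpen U) (haU : a ∈ U)
    (X : Fin n → CarnotMfd.VField n M) (hX : CarnotMfd.IsHFrameOn H X U)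
    (N : CarnotMfd.Euc n → ℝ) (hN : CarnotMfd.IsPseudoNorm H.weight N) :
    -- the map `ψ_{κ(a)}` exists and is unique
    (∀ κ : OpenPartialHomeomorph M (CarnotMfd.Euc n), CarnotMfd.IsCenteredChart a κ →
      CarnotMfd.IsPsiMap X H.weight a κ (CarnotMfd.psiMap X H.weight a κ) ∧
        ∀ ψ, CarnotMfd.IsPsiMap X H.weight a κ ψ → ψ = CarnotMfd.psiMap X H.weight a κ) ∧
    ∀ χ : OpenPartialHomeomorph M (CarnotMfd.Euc n),
      χ ∈ IsManifold.maximalAtlas (𝓡 n) ∞ M → a ∈ χ.source →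
      -- `χ` is privileged iff it is of the form `φ ∘ ψ_{κ(a)} ∘ κ` on its whole domain
      (CarnotMfd.Privileged X H.weight a χ ↔
        ∃ (κ : OpenPartialHomeomorph M (CarnotMfd.Euc n))
          (φ : OpenPartialHomeomorph (CarnotMfd.Euc n) (CarnotMfd.Euc n)),
          CarnotMfd.IsCenteredChart a κ ∧ CarnotMfd.IsAdmissibleChange H.weight N φ ∧
          χ.source = {p ∈ κ.source | CarnotMfd.psiMap X H.weight a κ (κ p) ∈ φ.source} ∧
          ∀ p ∈ χ.source, χ p = φ (CarnotMfd.psiMap X H.weight a κ (κ p))) ∧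
      -- and, for any `κ` given in advance, iff it is of that form near `a`
      ∀ κ : OpenPartialHomeomorph M (CarnotMfd.Euc n), CarnotMfd.IsCenteredChart a κ →
        (CarnotMfd.Privileged X H.weight a χ ↔
          ∃ φ : OpenPartialHomeomorph (CarnotMfd.Euc n) (CarnotMfd.Euc n),
            CarnotMfd.IsAdmissibleChange H.weight N φ ∧
            ∀ᶠ p in 𝓝 a, χ p = φ (CarnotMfd.psiMap X H.weight a κ (κ p))) := by
  refine ⟨fun κ hκ => CarnotMfd.isPsiMap_psiMap hU haU hX hκ.isSmoothCoord, fun χ hχ haχ => ?_⟩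
  have key : ∀ κ : OpenPartialHomeomorph M (CarnotMfd.Euc n), CarnotMfd.IsCenteredChart a κ →
      (CarnotMfd.Privileged X H.weight a χ ↔
        ∃ φ : OpenPartialHomeomorph (CarnotMfd.Euc n) (CarnotMfd.Euc n),
          CarnotMfd.IsAdmissibleChange H.weight N φ ∧
          ∀ᶠ p in 𝓝 a, χ p = φ (CarnotMfd.psiMap X H.weight a κ (κ p))) := by
    intro κ hκ
    obtain ⟨θ, hθ, hθp, hθψ⟩ :=
      (CarnotMfd.isPsiMap_psiMap hU haU hX hκ.isSmoothCoord).1.exists_isSmoothCoord haU hX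
        hκ.isSmoothCoord
    simp only [← hθψ]
    exact CarnotMfd.privileged_iff_exists_admissible hU haU hX hN hθ hθp hχ haχ
  refine ⟨⟨fun hp => ?_, ?_⟩, key⟩
  · have hχc : CarnotMfd.IsCenteredChart a χ := ⟨hχ, haχ, hp.1.1⟩
    -- For privileged χ both the affine and the triangular change may be the identity, so uniqueness
    -- gives ψ = id and the factorization holds on all of the domain.
    have hid : id = CarnotMfd.psiMap X H.weight a χ :=
      (CarnotMfd.isPsiMap_psiMap hU haU hX hχc.isSmoothCoord).2 id
        ⟨AffineEquiv.refl ℝ _, id, hp.1, CarnotMfd.isTriangularPoly_id _, hp, rfl⟩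
    refine ⟨χ, OpenPartialHomeomorph.refl _, hχc, CarnotMfd.isAdmissibleChange_refl _ N, ?_, ?_⟩
    · simp
    · simp [← hid]
  · rintro ⟨κ, φ, hκ, hφ, -, heq⟩
    exact (key κ hκ).2 ⟨φ, hφ, Filter.eventually_of_mem (χ.open_source.mem_nhds haχ) heq⟩
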